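/- Let $d\ge 0$ be an integer and $\sigma>0$. Let $\mathcal N_\sigma=\mathcal N(0,\sigma^2 I)$ on $\mathbb R^d$, with density $\varphi_\sigma(x)=(2\pi\sigma^2)^{-d/2}e^{-|x|^2/(2\sigma^2)}$. Let $\dot H^{1,2}(\mathcal N_\sigma)$ be the homogeneous Gaussian Sobolev space, that is, the completion of $\{g+a : g\in C_c^\infty(\mathbb R^d),\ a\in\mathbb R\}$ with respect to $\|\nabla u\|_{L^2(\mathcal N_\sigma;\mathbb R^d)}$, realized as a space of functions: $f\in L^2(\mathcal N_\sigma)$ belongs to it, with gradient $\nabla f\in L^2(\mathcal N_\sigma;\mathbb R^d)$, if there are $u_n$ in that set with $u_n\to f$ in $L^2(\mathcal N_\sigma)$ and $\nabla u_n\to\nabla f$ in $L^2(\mathcal N_\sigma;\mathbb R^d)$. Let $\dot H^{1,2}_0(\mathcal N_\sigma)=\{f\in\dot H^{1,2}(\mathcal N_\sigma):\int f\,d\mathcal N_\sigma=0\}$ and $$\dot H^{1,2}_0(\mathcal N_\sigma)*\varphi_\sigma=\{f*\varphi_\sigma : f\in\dot H^{1,2}_0(\mathcal N_\sigma)\}.$$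 For Borel probability measures $\mu,\nu$ on $\mathbb R^d$ let $$\mathsf d_2^{(\sigma)}(\mu,\nu)=\sup\Big\{\int f\,d\big((\mu-\nu)*\mathcal N_\sigma\big) : f\in C_c^\infty(\mathbb R^d),\ \|\nabla f\|_{L^2(\mathcal N_\sigma;\mathbb R^d)}\le 1\Big\}\in[0,\infty].$$ Let $\operatorname{Ein}(z)=\int_0^z(1-e^{-t})\,\frac{dt}{t}$ and $\kappa^{(\sigma)}(x,y)=-\sigma^2\operatorname{Ein}\!\big(-\langle x,y\rangle/\sigma^2\big)$ for $x,y\in\mathbb R^d$. (1) The formula $\langle f*\varphi_\sigma,\,g*\varphi_\sigma\rangle=\int\langle\nabla f,\nabla g\rangle\,d\mathcal N_\sigma$ for $f,g\in\dot H^{1,2}_0(\mathcal N_\sigma)$ is a well-defined inner product that makes $\dot H^{1,2}_0(\mathcal N_\sigma)*\varphi_\sigma$ a Hilbert space of functions on $\mathbb R^d$, and this space is an RKHS with reproducing kernel $\kappa^{(\sigma)}$: the kernel $\kappa^{(\sigma)}$ is positive semidefinite, $\kappa^{(\sigma)}(\cdot,x)$ belongs to the space for every $x\in\mathbb R^d$,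 and $h(x)=\langle h,\kappa^{(\sigma)}(\cdot,x)\rangle$ for every $x\in\mathbb R^d$ and every $h$ in the space. (2) Let $\mu,\nu$ be Borel probability measures on $\mathbb R^d$, and let $X,X'\sim\mu$ and $Y,Y'\sim\nu$ be independent. If $\mathbb E\sqrt{\kappa^{(\sigma)}(X,X)}<\infty$ and $\mathbb E\sqrt{\kappa^{(\sigma)}(Y,Y)}<\infty$, then $\kappa^{(\sigma)}(X,X')$, $\kappa^{(\sigma)}(Y,Y')$ and $\kappa^{(\sigma)}(X,Y)$ are integrable, $\mathsf d_2^{(\sigma)}(\mu,\nu)<\infty$ and $$\mathsf d_2^{(\sigma)}(\mu,\nu)^2=\mathbb E\,\kappa^{(\sigma)}(X,X')+\mathbb E\,\kappa^{(\sigma)}(Y,Y')-2\,\mathbb E\,\kappa^{(\sigma)}(X,Y).$$ -/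

import Mathlib

open MeasureTheory Filter Topology
open scoped ENNReal ContDiff Gradient Convolution RealInnerProductSpace

noncomputable section

namespace SmoothSobolev

/-- The `d`-dimensional Euclidean space. -/
abbrev E (d : ℕ) : Type := EuclideanSpace ℝ (Fin d)

/-! ### The isotropic Gaussian measure and its density -/

/-- The isotropic Gaussian measure `N(0, σ² I)` on `ℝ^d`. -/
def gauss (d : ℕ) (σ : ℝ) : Measure (E d) :=
  ProbabilityTheory.multivariateGaussian 0 (σ ^ 2 • (1 : Matrix (Fin d) (Fin d) ℝ))

instance (d : ℕ) (σ : ℝ) : IsProbabilityMeasure (gauss d σ) := by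
  unfold gauss; infer_instance

/-- The Gaussian density `(2πσ²)^(-d/2) exp(-|x|²/(2σ²))`. -/
def gaussDensity (d : ℕ) (σ : ℝ) (x : E d) : ℝ :=
  (2 * Real.pi * σ ^ 2) ^ (-(d : ℝ) / 2) * Real.exp (-‖x‖ ^ 2 / (2 * σ ^ 2))

lemma continuous_gaussDensity (d : ℕ) (σ : ℝ) : Continuous (gaussDensity d σ) := by
  unfold gaussDensity; fun_prop

lemma gaussDensity_pos (d : ℕ) {σ : ℝ} (hσ : 0 < σ) (x : E d) : 0 < gaussDensity d σ x := by
  unfold gaussDensity; positivity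

lemma integrable_exp_quadratic (d : ℕ) {b : ℝ} (hb : 0 < b) (w : E d) :
    Integrable (fun v : E d => Real.exp (-b * ‖v‖ ^ 2 + ⟪w, v⟫)) := by
  have h := (GaussianFourier.integrable_cexp_neg_mul_sq_norm_add (V := E d) (b := (b : ℂ))
    (by simpa using hb) 1 w).re
  refine h.congr (ae_of_all _ fun v => ?_)
  have : (-(b : ℂ) * (‖v‖ : ℂ) ^ 2 + 1 * ((⟪w, v⟫ : ℝ) : ℂ))
      = ((-b * ‖v‖ ^ 2 + ⟪w, v⟫ : ℝ) : ℂ) := by push_cast; ring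
  simp only [this, ← Complex.ofReal_exp]
  rfl

/-- `gaussDensity` is the Lebesgue density of the Gaussian measure. -/
lemma gauss_eq_withDensity (d : ℕ) {σ : ℝ} (hσ : 0 < σ) :
    gauss d σ = volume.withDensity fun x => ENNReal.ofReal (gaussDensity d σ x) := by
  have hint : Integrable (gaussDensity d σ) := by
    have := (integrable_exp_quadratic d (b := 1 / (2 * σ ^ 2)) (by positivity) 0).const_mul
      ((2 * Real.pi * σ ^ 2) ^ (-(d : ℝ) / 2))
    refine this.congr (ae_of_all _ fun v => ?_)
    simp only [gaussDensity, inner_zero_left, add_zero]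
    congr 2; ring
  have : IsFiniteMeasure (volume.withDensity fun x => ENNReal.ofReal (gaussDensity d σ x)) :=
    isFiniteMeasure_withDensity_ofReal hint.2
  refine Measure.ext_of_charFun ?_
  funext t
  have hS : (σ ^ 2 • (1 : Matrix (Fin d) (Fin d) ℝ)).PosSemidef :=
    Matrix.PosSemidef.one.smul (sq_nonneg σ)
  have hS2 : (t.ofLp ⬝ᵥ (σ ^ 2 • (1 : Matrix (Fin d) (Fin d) ℝ)).mulVec t.ofLp)
      = σ ^ 2 * ‖t‖ ^ 2 := by
    rw [Matrix.smul_mulVec, Matrix.one_mulVec, dotProduct_smul, EuclideanSpace.real_norm_sq_eq]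
    simp [dotProduct, pow_two]
  rw [gauss, ProbabilityTheory.charFun_multivariateGaussian hS, charFun_apply,
    integral_withDensity_eq_integral_toReal_smul (by
      exact (continuous_gaussDensity d σ).measurable.ennreal_ofReal) (by simp)]
  have key := GaussianFourier.integral_cexp_neg_mul_sq_norm_add (V := E d)
    (b := ((1 / (2 * σ ^ 2) : ℝ) : ℂ))
    (by rw [Complex.ofReal_re]; positivity) Complex.I t
  have e1 : ∀ x : E d, (ENNReal.ofReal (gaussDensity d σ x)).toReal •
      Complex.exp (((⟪x, t⟫ : ℝ) : ℂ) * Complex.I)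
      = (((2 * Real.pi * σ ^ 2) ^ (-(d : ℝ) / 2) : ℝ) : ℂ) *
        Complex.exp (-((1 / (2 * σ ^ 2) : ℝ) : ℂ) * (‖x‖ : ℂ) ^ 2
          + Complex.I * ((⟪t, x⟫ : ℝ) : ℂ)) := by
    intro x
    rw [ENNReal.toReal_ofReal (gaussDensity_pos d hσ x).le, Complex.exp_add, gaussDensity,
      Complex.real_smul, real_inner_comm]
    push_cast
    rw [mul_assoc]
    congr 2
    · congr 1; ring
    · congr 1; ring
  simp_rw [e1]
  rw [integral_const_mul, key, hS2]
  have hpos : (0 : ℝ) < 2 * Real.pi * σ ^ 2 := by positivity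
  have hb : ((Real.pi : ℂ) / ((1 / (2 * σ ^ 2) : ℝ) : ℂ)) = ((2 * Real.pi * σ ^ 2 : ℝ) : ℂ) := by
    push_cast; field_simp
  have hd : (((Module.finrank ℝ (E d) : ℕ) : ℂ) / 2) = (((d : ℝ) / 2 : ℝ) : ℂ) := by
    simp
  rw [hb, hd, ← Complex.ofReal_cpow hpos.le, ← mul_assoc, ← Complex.ofReal_mul,
    ← Real.rpow_add hpos]
  have : -(d : ℝ) / 2 + (d : ℝ) / 2 = 0 := by ring
  rw [this, Real.rpow_zero, Complex.ofReal_one, one_mul]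
  congr 1
  simp only [inner_zero_right, Complex.ofReal_zero, zero_mul, zero_sub, Complex.I_sq]
  have hσ' : (σ : ℂ) ≠ 0 := by exact_mod_cast hσ.ne'
  push_cast
  field_simp
  ring

/-! ### The homogeneous Sobolev space of order `(1, 2)` -/

/-- Compactly supported smooth real functions plus constants. -/
def testFunctions (d : ℕ) : Set (E d → ℝ) :=
  {u | ∃ (g : E d → ℝ) (a : ℝ), ContDiff ℝ ∞ g ∧ HasCompactSupport g ∧ u = fun x => g x + a}

/-- `MemSobolev γ f F`: the function `f` belongs to the homogeneous Sobolev space of order `(1, 2)`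
over `γ`, with gradient `F`. The space is the completion of the test functions with respect to
the seminorm `‖∇u‖_{L²(γ)}`, realized as a space of functions in `L²(γ)`: `u n → f` in `L²(γ)` and
`∇ (u n) → F` in `L²(γ; ℝ^d)` for some sequence of test functions. -/
structure MemSobolev {d : ℕ} (γ : Measure (E d)) (f : E d → ℝ) (F : E d → E d) : Prop where
  memLp : MemLp f 2 γ
  memLp_grad : MemLp F 2 γ
  exists_seq : ∃ u : ℕ → E d → ℝ, (∀ n, u n ∈ testFunctions d) ∧
    Tendsto (fun n => eLpNorm (u n - f) 2 γ) atTop (𝓝 0) ∧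
    Tendsto (fun n => eLpNorm (∇ (u n) - F) 2 γ) atTop (𝓝 0)

/-- The subspace of functions with `γ`-mean zero. -/
structure MemSobolevZero {d : ℕ} (γ : Measure (E d)) (f : E d → ℝ) (F : E d → E d) : Prop
    extends MemSobolev γ f F where
  mean_zero : ∫ x, f x ∂γ = 0

/-- The convolution `f * φ_σ` of functions on `ℝ^d` with respect to Lebesgue measure. -/
def smooth {d : ℕ} (σ : ℝ) (f : E d → ℝ) : E d → ℝ :=
  f ⋆[ContinuousLinearMap.mul ℝ ℝ, volume] gaussDensity d σ

section helpers

variable {d : ℕ}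

lemma testFunctions_contDiff {u : E d → ℝ} (hu : u ∈ testFunctions d) : ContDiff ℝ ∞ u := by
  obtain ⟨g, a, hg, -, rfl⟩ := hu
  exact hg.add contDiff_const

lemma testFunctions_zero : (0 : E d → ℝ) ∈ testFunctions d :=
  ⟨0, 0, contDiff_const, HasCompactSupport.zero, by ext; simp⟩

lemma testFunctions_add {u v : E d → ℝ} (hu : u ∈ testFunctions d) (hv : v ∈ testFunctions d) :
    u + v ∈ testFunctions d := by
  obtain ⟨g, a, hg, hg', rfl⟩ := hu
  obtain ⟨h, b, hh, hh', rfl⟩ := hv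
  exact ⟨g + h, a + b, hg.add hh, hg'.add hh', by ext; simp; ring⟩

lemma testFunctions_smul {u : E d → ℝ} (c : ℝ) (hu : u ∈ testFunctions d) :
    c • u ∈ testFunctions d := by
  obtain ⟨g, a, hg, hg', rfl⟩ := hu
  exact ⟨c • g, c * a, contDiff_const.smul hg, hg'.smul_left (f := fun _ => c),
    by ext; simp; ring⟩

lemma gradient_add' {u v : E d → ℝ} (hu : ContDiff ℝ ∞ u) (hv : ContDiff ℝ ∞ v) :
    ∇ (u + v) = ∇ u + ∇ v := by
  funext x
  simp only [gradient, Pi.add_apply]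
  rw [fderiv_add (hu.differentiable (by simp) x) (hv.differentiable (by simp) x), map_add]

lemma gradient_smul' {u : E d → ℝ} (c : ℝ) (hu : ContDiff ℝ ∞ u) :
    ∇ (c • u) = c • ∇ u := by
  funext x
  simp only [gradient, Pi.smul_apply]
  rw [fderiv_const_smul (hu.differentiable (by simp) x), map_smul]

lemma continuous_gradient {u : E d → ℝ} (hu : ContDiff ℝ ∞ u) : Continuous (∇ u) :=
  (LinearIsometryEquiv.continuous _).comp (hu.continuous_fderiv (by simp))

variable {γ : Measure (E d)} {f g : E d → ℝ} {F G : E d → E d}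

lemma MemSobolev.zero : MemSobolev γ (0 : E d → ℝ) 0 :=
  ⟨MemLp.zero, MemLp.zero, fun _ => 0, fun _ => testFunctions_zero, by simp, by
    have : ∇ (0 : E d → ℝ) = 0 := gradient_const' (0 : ℝ)
    simp [this]⟩

lemma MemSobolev.add (hf : MemSobolev γ f F) (hg : MemSobolev γ g G) :
    MemSobolev γ (f + g) (F + G) := by
  obtain ⟨u, hu, hu1, hu2⟩ := hf.exists_seq
  obtain ⟨v, hv, hv1, hv2⟩ := hg.exists_seq
  refine ⟨hf.memLp.add hg.memLp, hf.memLp_grad.add hg.memLp_grad, fun n => u n + v n,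
    fun n => testFunctions_add (hu n) (hv n), ?_, ?_⟩
  · have h := hu1.add hv1
    rw [add_zero] at h
    refine tendsto_of_tendsto_of_tendsto_of_le_of_le tendsto_const_nhds h
      (fun n => zero_le) fun n => ?_
    have e : u n + v n - (f + g) = (u n - f) + (v n - g) := by abel
    simp only [e]
    exact eLpNorm_add_le
      ((testFunctions_contDiff (hu n)).continuous.aestronglyMeasurable.sub hf.memLp.1)
      ((testFunctions_contDiff (hv n)).continuous.aestronglyMeasurable.sub hg.memLp.1) (by simp)
  · have h := hu2.add hv2
    rw [add_zero] at h
    refine tendsto_of_tendsto_of_tendsto_of_le_of_le tendsto_const_nhds h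
      (fun n => zero_le) fun n => ?_
    have e : ∇ (u n + v n) - (F + G) = (∇ (u n) - F) + (∇ (v n) - G) := by
      rw [gradient_add' (testFunctions_contDiff (hu n)) (testFunctions_contDiff (hv n))]; abel
    simp only [e]
    exact eLpNorm_add_le
      ((continuous_gradient (testFunctions_contDiff (hu n))).aestronglyMeasurable.sub
        hf.memLp_grad.1)
      ((continuous_gradient (testFunctions_contDiff (hv n))).aestronglyMeasurable.sub
        hg.memLp_grad.1) (by simp)

lemma MemSobolev.smul (c : ℝ) (hf : MemSobolev γ f F) : MemSobolev γ (c • f) (c • F) := by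
  obtain ⟨u, hu, hu1, hu2⟩ := hf.exists_seq
  refine ⟨hf.memLp.const_smul c, hf.memLp_grad.const_smul c, fun n => c • u n,
    fun n => testFunctions_smul c (hu n), ?_, ?_⟩
  · have e : ∀ n, c • u n - c • f = c • (u n - f) := fun n => (smul_sub _ _ _).symm
    simp only [e, eLpNorm_const_smul]
    simpa using ENNReal.Tendsto.const_mul hu1 (Or.inr (by simp))
  · have e : ∀ n, ∇ (c • u n) - c • F = c • (∇ (u n) - F) := fun n => by
      rw [gradient_smul' c (testFunctions_contDiff (hu n)), smul_sub]
    simp only [e, eLpNorm_const_smul]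
    simpa using ENNReal.Tendsto.const_mul hu2 (Or.inr (by simp))

/-- The convolution of a function in `L²(N_σ)` with `φ_σ` converges absolutely everywhere. -/
lemma convolutionExists_gaussDensity {σ : ℝ} (hσ : 0 < σ) (hf : MemLp f 2 (gauss d σ)) :
    ConvolutionExists f (gaussDensity d σ) (ContinuousLinearMap.mul ℝ ℝ) volume := by
  intro x
  set r : E d → ℝ := fun t => gaussDensity d σ (x - t) / gaussDensity d σ t with hr
  have hpos := gaussDensity_pos d hσ
  have hc := continuous_gaussDensity d σ
  have hrc : Continuous r :=
    (hc.comp (continuous_const.sub continuous_id)).div hc fun t => (hpos t).ne'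
  have hwd : ∀ h : E d → ℝ, Integrable h (gauss d σ) ↔
      Integrable (fun t => gaussDensity d σ t * h t) volume := by
    intro h
    rw [gauss_eq_withDensity d hσ, integrable_withDensity_iff_integrable_smul'
      hc.measurable.ennreal_ofReal (by simp)]
    simp only [ENNReal.toReal_ofReal (hpos _).le, smul_eq_mul]
  have hr2 : MemLp r 2 (gauss d σ) := by
    rw [memLp_two_iff_integrable_sq hrc.aestronglyMeasurable, hwd]
    have := (integrable_exp_quadratic d (b := 1 / (2 * σ ^ 2)) (by positivity)
      ((2 / σ ^ 2) • x)).const_mul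
        ((2 * Real.pi * σ ^ 2) ^ (-(d : ℝ) / 2) * Real.exp (-‖x‖ ^ 2 / σ ^ 2))
    refine this.congr (ae_of_all _ fun t => ?_)
    have hC : (0 : ℝ) < (2 * Real.pi * σ ^ 2) ^ (-(d : ℝ) / 2) := by positivity
    have hrt : r t = Real.exp (-‖x‖ ^ 2 / (2 * σ ^ 2) + ⟪x, t⟫ / σ ^ 2) := by
      simp only [hr, gaussDensity]
      rw [mul_div_mul_left _ _ hC.ne', ← Real.exp_sub, norm_sub_sq_real]
      congr 1; field_simp; ring
    simp only [hrt, gaussDensity]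
    rw [← Real.exp_nat_mul, mul_assoc (_ ^ _) (Real.exp _) (Real.exp _),
      mul_assoc (_ ^ _) (Real.exp _) (Real.exp _), ← Real.exp_add, ← Real.exp_add,
      real_inner_smul_left]
    congr 2; push_cast; field_simp; ring
  have := (hwd _).1 (hf.integrable_mul hr2)
  refine this.congr (ae_of_all _ fun t => ?_)
  simp only [hr, Pi.mul_apply, ContinuousLinearMap.mul_apply']
  field_simp [(hpos t).ne']

end helpers

/-- The vector space `{f * φ_σ : f in the mean-zero homogeneous Sobolev space over N_σ}` of
real-valued functions on `ℝ^d`. -/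
def smoothedSobolevSpace (d : ℕ) (σ : ℝ) (hσ : 0 < σ) : Submodule ℝ (E d → ℝ) where
  carrier := {h | ∃ f F, MemSobolevZero (gauss d σ) f F ∧ h = smooth σ f}
  zero_mem' := ⟨0, 0, ⟨MemSobolev.zero, by simp⟩, by ext; simp [smooth]⟩
  add_mem' := by
    rintro _ _ ⟨f, F, hf, rfl⟩ ⟨g, G, hg, rfl⟩
    refine ⟨f + g, F + G, ⟨hf.toMemSobolev.add hg.toMemSobolev, ?_⟩, ?_⟩
    · simp only [Pi.add_apply]
      rw [integral_add (hf.memLp.integrable (by simp)) (hg.memLp.integrable (by simp)),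
        hf.mean_zero, hg.mean_zero, add_zero]
    · exact ((convolutionExists_gaussDensity hσ hf.memLp).add_distrib
        (convolutionExists_gaussDensity hσ hg.memLp)).symm
  smul_mem' := by
    rintro c _ ⟨f, F, hf, rfl⟩
    refine ⟨c • f, c • F, ⟨hf.toMemSobolev.smul c, ?_⟩, ?_⟩
    · simp only [Pi.smul_apply]
      rw [integral_smul, hf.mean_zero, smul_zero]
    · exact smul_convolution.symm

/-! ### Reproducing kernel Hilbert spaces of real functions -/

/-- A vector space `H` of real functions on `X`, with inner product `c`, is a Hilbert space with
reproducing kernel `k`. -/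
structure IsRKHS {X : Type*} (H : Submodule ℝ (X → ℝ)) (c : InnerProductSpace.Core ℝ H)
    (k : X → X → ℝ) : Prop where
  complete : @CompleteSpace H
    c.toNormedAddCommGroup.toMetricSpace.toPseudoMetricSpace.toUniformSpace
  posSemidef : (Matrix.of k).PosSemidef
  kernel_mem : ∀ x, (fun y => k y x) ∈ H
  reproducing : ∀ (x : X) (h : H), h.1 x = c.inner h ⟨fun y => k y x, kernel_mem x⟩

/-- The entire exponential integral. -/
def Ein (z : ℝ) : ℝ := ∫ t in (0 : ℝ)..z, (1 - Real.exp (-t)) / t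

/-- The kernel `-σ² Ein(-⟨x,y⟩/σ²)`. -/
def kernel (d : ℕ) (σ : ℝ) (x y : E d) : ℝ := -σ ^ 2 * Ein (-⟪x, y⟫ / σ ^ 2)

/-! ### The smooth Sobolev integral probability metric -/

/-- The dual Sobolev norm of order `(-1, 2)` over `γ` of a signed measure `ℓ`, i.e. the supremum of
`ℓ(f)` over `f ∈ C_c^∞` with `‖∇f‖_{L²(γ)} ≤ 1`; it may be infinite. -/
def dualSobolevNorm {d : ℕ} (γ : Measure (E d)) (ℓ : SignedMeasure (E d)) : EReal :=
  ⨆ f ∈ {f : E d → ℝ | ContDiff ℝ ∞ f ∧ HasCompactSupport f ∧ eLpNorm (∇ f) 2 γ ≤ 1},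
    ((∫ᵛ x, f x ∂<•ℓ : ℝ) : EReal)

/-- The smooth Sobolev integral probability metric of order two: the dual Sobolev norm over `N_σ`
of `(μ - ν) * N_σ`. -/
def smoothSobolevIPM {d : ℕ} (σ : ℝ) (μ ν : Measure (E d)) [IsProbabilityMeasure μ]
    [IsProbabilityMeasure ν] : EReal :=
  dualSobolevNorm (gauss d σ)
    ((μ.conv (gauss d σ)).toSignedMeasure - (ν.conv (gauss d σ)).toSignedMeasure)

end SmoothSobolev

end

/-!
Write `γ = N(0, σ² I)` and let `E_y(t) = exp (⟨y, t⟩ / σ² - |y|² / (2σ²))` be the density of the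
translate of `γ` by `y` with respect to `γ`. Then `(f * φ_σ)(y) = ∫ f E_y dγ` (`smooth_apply`).
Differentiating along the segment from `0` to `x` gives, for a Sobolev function `f` of mean zero,
`(f * φ_σ)(x) = ∫₀¹ ∫ ⟨∇f, x⟩ E_{ux} dγ du = ⟪∇f, G_x⟫`, where `G_x(t) = (∫₀¹ E_{ux}(t) du) x` is
an element of `L²(γ; ℝ^d)` (`kernelField`, `MemSobolevZero.smooth_eq`). Since
`⟪E_y v, E_z w⟫ = ⟨v, w⟩ exp (⟨y, z⟩ / σ²)`, the Gram kernel of `x ↦ G_x` is the double integral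
`∫₀¹ ∫₀¹ ⟨x, y⟩ exp (u v ⟨x, y⟩ / σ²) du dv = κ(x, y)` (`inner_kernelField_kernelField`).

The space of smoothed functions is therefore a copy of the closed span `gradientSpace` of the
gradients of test functions in `L²(γ; ℝ^d)`, by `F ↦ (x ↦ ⟪F, G_x⟫)`. Three facts enter.

* The map is injective, and the gradient is well defined: if `f * φ_σ = 0`, then differentiating
  along lines shows that `∇f` is orthogonal to all fields `E_y v`, and these are total because a
  finite measure with finite exponential moments is determined by them
  (`ae_eq_zero_of_integral_mul_cameronMartin`, `MemSobolev.grad_eq_zero`).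
* Every element of `gradientSpace` is the gradient of a function in `L²(γ)`. This is the Gaussian
  Poincaré inequality with some constant, obtained from the rotation invariance of `γ ⊗ γ`
  (`exists_poincare`, `exists_memSobolevZero`).
* `G_x` lies in `gradientSpace`, because `σ⁻² E_y y = ∇E_y` is a limit of gradients of cutoffs of
  `E_y` (`kernelField_mem`).

For the metric, integrating `f * φ_σ = ∫ f dγ + ⟪∇f, G_x⟫` against `μ - ν` gives `⟪∇f, m⟫`
with the Bochner integral `m = ∫ G dμ - ∫ G dν`, which exists because `‖G_x‖ = √κ(x, x)`. As `m`
lies in `gradientSpace`, the supremum over `‖∇f‖ ≤ 1` is `‖m‖` (`smoothSobolevIPM_eq_norm`), and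
expanding `‖m‖²` by means of the Gram kernel gives the formula.
-/

noncomputable section

namespace SmoothSobolev

variable {d : ℕ} {σ : ℝ}

/-! ### Gaussian densities of translates -/

lemma integral_gauss (hσ : 0 < σ) {W : Type*} [NormedAddCommGroup W] [NormedSpace ℝ W]
    (f : E d → W) : ∫ t, f t ∂(gauss d σ) = ∫ t, gaussDensity d σ t • f t := by
  rw [gauss_eq_withDensity d hσ, integral_withDensity_eq_integral_toReal_smul
    (continuous_gaussDensity d σ).measurable.ennreal_ofReal (by simp)]
  simp only [ENNReal.toReal_ofReal (gaussDensity_pos d hσ _).le]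

lemma integrable_gauss_iff (hσ : 0 < σ) {f : E d → ℝ} :
    Integrable f (gauss d σ) ↔ Integrable (fun t => gaussDensity d σ t * f t) volume := by
  rw [gauss_eq_withDensity d hσ, integrable_withDensity_iff_integrable_smul'
    (continuous_gaussDensity d σ).measurable.ennreal_ofReal (by simp)]
  simp only [ENNReal.toReal_ofReal (gaussDensity_pos d hσ _).le, smul_eq_mul]

lemma integrable_gaussDensity (hσ : 0 < σ) : Integrable (gaussDensity d σ) volume := by
  simpa using (integrable_gauss_iff hσ).1 (integrable_const (1 : ℝ))

lemma integral_gaussDensity (hσ : 0 < σ) : ∫ t, gaussDensity d σ t = 1 := by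
  simpa using (integral_gauss hσ (fun _ : E d => (1 : ℝ))).symm

lemma gaussDensity_neg (t : E d) : gaussDensity d σ (-t) = gaussDensity d σ t := by
  simp [gaussDensity]

/-- The density `exp (⟨y, t⟩ / σ² - |y|² / (2σ²))` with respect to `N(0, σ² I)` of its translate
by `y`. -/
def cameronMartin (σ : ℝ) (y t : E d) : ℝ :=
  Real.exp (⟪y, t⟫ / σ ^ 2 - ‖y‖ ^ 2 / (2 * σ ^ 2))

lemma continuous_cameronMartin (y : E d) : Continuous (cameronMartin σ y) := by
  unfold cameronMartin; fun_prop

lemma cameronMartin_pos (y t : E d) : 0 < cameronMartin σ y t := Real.exp_pos _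

@[simp] lemma cameronMartin_zero (t : E d) : cameronMartin σ 0 t = 1 := by
  simp [cameronMartin]

lemma gaussDensity_sub (hσ : 0 < σ) (y t : E d) :
    gaussDensity d σ (y - t) = gaussDensity d σ t * cameronMartin σ y t := by
  simp only [gaussDensity, cameronMartin]
  rw [mul_assoc (_ ^ _) (Real.exp _) (Real.exp _), ← Real.exp_add, norm_sub_sq_real]
  congr 2; field_simp; ring

lemma cameronMartin_mul (hσ : 0 < σ) (y z t : E d) :
    cameronMartin σ y t * cameronMartin σ z t
      = Real.exp (⟪y, z⟫ / σ ^ 2) * cameronMartin σ (y + z) t := by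
  simp only [cameronMartin]
  rw [← Real.exp_add, ← Real.exp_add, norm_add_sq_real, inner_add_left]
  congr 1; field_simp; ring

lemma integrable_cameronMartin (hσ : 0 < σ) (y : E d) :
    Integrable (cameronMartin σ y) (gauss d σ) := by
  rw [integrable_gauss_iff hσ]
  simpa only [gaussDensity_sub hσ] using (integrable_gaussDensity hσ).comp_sub_left y

lemma integral_cameronMartin (hσ : 0 < σ) (y : E d) :
    ∫ t, cameronMartin σ y t ∂(gauss d σ) = 1 := by
  rw [integral_gauss hσ]
  simp only [smul_eq_mul, ← gaussDensity_sub hσ]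
  rw [integral_sub_left_eq_self (gaussDensity d σ), integral_gaussDensity hσ]

lemma integral_cameronMartin_mul (hσ : 0 < σ) (y z : E d) :
    ∫ t, cameronMartin σ y t * cameronMartin σ z t ∂(gauss d σ)
      = Real.exp (⟪y, z⟫ / σ ^ 2) := by
  simp only [cameronMartin_mul hσ]
  rw [integral_const_mul, integral_cameronMartin hσ, mul_one]

lemma memLp_cameronMartin (hσ : 0 < σ) (y : E d) :
    MemLp (cameronMartin σ y) 2 (gauss d σ) := by
  rw [memLp_two_iff_integrable_sq (continuous_cameronMartin y).aestronglyMeasurable]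
  simp only [pow_two, cameronMartin_mul hσ]
  exact (integrable_cameronMartin hσ _).const_mul _

/-- Smoothing is the pairing with the Cameron–Martin densities. -/
lemma smooth_apply (hσ : 0 < σ) (f : E d → ℝ) (x : E d) :
    smooth σ f x = ∫ t, f t * cameronMartin σ x t ∂(gauss d σ) := by
  rw [integral_gauss hσ]
  simp only [smooth, convolution, ContinuousLinearMap.mul_apply', gaussDensity_sub hσ, smul_eq_mul]
  congr 1; ext t; ring

lemma smooth_apply_translate (hσ : 0 < σ) (f : E d → ℝ) (x : E d) :
    smooth σ f x = ∫ z, f (x + z) ∂(gauss d σ) := by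
  rw [integral_gauss hσ, ← integral_sub_right_eq_self _ x]
  simp only [smooth, convolution, ContinuousLinearMap.mul_apply', smul_eq_mul]
  congr 1; ext t
  rw [← gaussDensity_neg (t - x), neg_sub, add_sub_cancel, mul_comm]

/-! ### Totality of the Cameron–Martin densities -/

/-- Finite measures on a Euclidean space whose moment generating functions are finite and equal
everywhere are equal. -/
lemma ext_of_integral_exp_inner {μ ν : Measure (E d)} [IsFiniteMeasure μ] [IsFiniteMeasure ν]
    (hμ : ∀ y, Integrable (fun t => Real.exp ⟪y, t⟫) μ)
    (h : ∀ y, ∫ t, Real.exp ⟪y, t⟫ ∂μ = ∫ t, Real.exp ⟪y, t⟫ ∂ν) : μ = ν := by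
  refine Measure.ext_of_charFun (funext fun y => ?_)
  have hm : ProbabilityTheory.mgf (fun t => ⟪y, t⟫) μ
      = ProbabilityTheory.mgf (fun t => ⟪y, t⟫) ν := by
    funext s
    simpa [ProbabilityTheory.mgf, real_inner_smul_left] using h (s • y)
  have h0 : μ = 0 ↔ ν = 0 := by
    have h1 := h 0
    simp only [inner_zero_left, Real.exp_zero, integral_const, smul_eq_mul, mul_one] at h1
    rw [← Measure.measure_univ_eq_zero, ← Measure.measure_univ_eq_zero,
      ← measureReal_eq_zero_iff, ← measureReal_eq_zero_iff, h1]
  have hset : ProbabilityTheory.integrableExpSet (fun t => ⟪y, t⟫) μ = Set.univ := by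
    refine Set.eq_univ_of_forall fun s => ?_
    simpa [ProbabilityTheory.integrableExpSet, real_inner_smul_left] using hμ (s • y)
  have hc := ProbabilityTheory.eqOn_complexMGF_of_mgf' hm h0
    (x := Complex.I) (by simp [hset])
  simp only [ProbabilityTheory.complexMGF] at hc
  rw [charFun_apply, charFun_apply]
  simpa [mul_comm, real_inner_comm] using hc

lemma ae_eq_zero_of_integral_mul_cameronMartin (hσ : 0 < σ) {g : E d → ℝ}
    (hg : MemLp g 2 (gauss d σ)) (h : ∀ y, ∫ t, g t * cameronMartin σ y t ∂(gauss d σ) = 0) :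
    g =ᵐ[gauss d σ] 0 := by
  have hi : Integrable g (gauss d σ) := hg.integrable (by simp)
  set γ := gauss d σ
  -- the exponentials with parameter `y` are multiples of the densities with parameter `σ² y`
  have hexp : ∀ y t : E d, Real.exp ⟪y, t⟫
      = Real.exp (‖y‖ ^ 2 * σ ^ 2 / 2) * cameronMartin σ (σ ^ 2 • y) t := by
    intro y t
    rw [cameronMartin, ← Real.exp_add, real_inner_smul_left, norm_smul, mul_pow]
    congr 1
    simp only [norm_pow, Real.norm_eq_abs, sq_abs]
    field_simp; ring
  have hie : ∀ y : E d, Integrable (fun t => g t * Real.exp ⟪y, t⟫) γ := by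
    intro y
    simp only [hexp]
    exact hg.integrable_mul ((memLp_cameronMartin hσ (σ ^ 2 • y)).const_mul _)
  have h0 : ∀ y : E d, ∫ t, g t * Real.exp ⟪y, t⟫ ∂γ = 0 := by
    intro y
    simp only [hexp, mul_left_comm (g _)]
    rw [integral_const_mul, h, mul_zero]
  -- a measure with density the positive part of `± g`, and its exponential moments
  have key : ∀ f : E d → ℝ, Integrable f γ →
      (∀ y : E d, Integrable (fun t => f t * Real.exp ⟪y, t⟫) γ) →
      IsFiniteMeasure (γ.withDensity fun t => ENNReal.ofReal (f t)) ∧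
      (∀ y : E d, Integrable (fun t => max (f t) 0 * Real.exp ⟪y, t⟫) γ) ∧
      (∀ y : E d, Integrable (fun t => Real.exp ⟪y, t⟫)
        (γ.withDensity fun t => ENNReal.ofReal (f t))) ∧
      ∀ y : E d, ∫ t, Real.exp ⟪y, t⟫ ∂(γ.withDensity fun t => ENNReal.ofReal (f t))
        = ∫ t, max (f t) 0 * Real.exp ⟪y, t⟫ ∂γ := by
    intro f hf hfe
    have hmax : ∀ y : E d, Integrable (fun t => max (f t) 0 * Real.exp ⟪y, t⟫) γ := by
      intro y
      refine (hfe y).pos_part.congr (ae_of_all _ fun t => ?_)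
      simp only [max_mul_of_nonneg _ _ (Real.exp_pos ⟪y, t⟫).le, zero_mul]
    refine ⟨isFiniteMeasure_withDensity_ofReal hf.2, hmax, fun y => ?_, fun y => ?_⟩
    · rw [integrable_withDensity_iff_integrable_smul₀' hf.aemeasurable.ennreal_ofReal (by simp)]
      simpa [ENNReal.toReal_ofReal'] using hmax y
    · rw [integral_withDensity_eq_integral_toReal_smul₀ hf.aemeasurable.ennreal_ofReal (by simp)]
      simp [ENNReal.toReal_ofReal']
  obtain ⟨_, p1, p2, p3⟩ := key g hi hie
  obtain ⟨_, n1, n2, n3⟩ := key (fun t => -g t) hi.neg (fun y => by simpa using (hie y).neg)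
  have heq := ext_of_integral_exp_inner (ν := γ.withDensity fun t => ENNReal.ofReal ((-g) t)) p2
    (fun y => by
      refine (p3 y).trans (Eq.trans ?_ (n3 y).symm)
      rw [← sub_eq_zero, ← integral_sub (p1 y) (n1 y)]
      refine Eq.trans (integral_congr_ae (ae_of_all _ fun t => ?_)) (h0 y)
      simp only
      rw [← sub_mul, max_zero_sub_max_neg_zero_eq_self])
  rw [withDensity_eq_iff hi.aemeasurable.ennreal_ofReal hi.neg.aemeasurable.ennreal_ofReal
    (hi.lintegral_lt_top).ne] at heq
  filter_upwards [heq] with t ht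
  rcases le_total (g t) 0 with hg0 | hg0
  · rw [ENNReal.ofReal_of_nonpos hg0, eq_comm, ENNReal.ofReal_eq_zero] at ht
    exact le_antisymm hg0 (by simpa using ht)
  · rw [ENNReal.ofReal_of_nonpos (by simpa using hg0 : (-g) t ≤ 0), ENNReal.ofReal_eq_zero] at ht
    exact le_antisymm ht hg0

/-! ### The kernel vectors in `L²(γ; ℝ^d)` -/

lemma memLp_cameronMartin_smul (hσ : 0 < σ) (y v : E d) :
    MemLp (fun t => cameronMartin σ y t • v) 2 (gauss d σ) :=
  (memLp_top_const v).smul (memLp_cameronMartin hσ y)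

/-- The vector field `t ↦ E_y(t) v` in `L²(γ; ℝ^d)`, where `E_y` is the Cameron–Martin density. -/
@[irreducible] def expField (hσ : 0 < σ) (y v : E d) : Lp (E d) 2 (gauss d σ) :=
  (memLp_cameronMartin_smul hσ y v).toLp

lemma inner_toLp (hσ : 0 < σ) {F : E d → E d} (hF : MemLp F 2 (gauss d σ)) (y v : E d) :
    ⟪hF.toLp, expField hσ y v⟫ = ∫ t, ⟪F t, v⟫ * cameronMartin σ y t ∂(gauss d σ) := by
  rw [L2.inner_def]
  refine integral_congr_ae ?_
  filter_upwards [hF.coeFn_toLp, (memLp_cameronMartin_smul hσ y v).coeFn_toLp] with t h1 h2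
  rw [h1, expField, h2, real_inner_smul_right, mul_comm]

lemma inner_expField (hσ : 0 < σ) (y v z w : E d) :
    ⟪expField hσ y v, expField hσ z w⟫ = ⟪v, w⟫ * Real.exp (⟪y, z⟫ / σ ^ 2) := by
  rw [expField, inner_toLp]
  simp only [real_inner_smul_left, mul_right_comm _ _ (cameronMartin σ z _)]
  rw [integral_mul_const, integral_cameronMartin_mul hσ, mul_comm]

lemma expField_smul (hσ : 0 < σ) (c : ℝ) (y v : E d) :
    expField hσ y (c • v) = c • expField hσ y v := by
  rw [expField, expField, ← MemLp.toLp_const_smul]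
  refine MemLp.toLp_congr _ _ (ae_of_all _ fun t => ?_)
  simp only [Pi.smul_apply, smul_comm c]

/-- A map into an inner product space is continuous if its Gram kernel is. -/
lemma continuous_of_continuous_inner {X V : Type*} [TopologicalSpace X]
    [NormedAddCommGroup V] [InnerProductSpace ℝ V] {f : X → V}
    (h : Continuous fun p : X × X => ⟪f p.1, f p.2⟫) : Continuous f := by
  rw [continuous_iff_continuousAt]
  intro a
  rw [ContinuousAt, tendsto_iff_norm_sub_tendsto_zero]
  have h1 : Continuous fun x => ⟪f x, f x⟫ := h.comp (by fun_prop : Continuous fun x => (x, x))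
  have h2 : Continuous fun x => ⟪f x, f a⟫ := h.comp (by fun_prop : Continuous fun x => (x, a))
  have h3 : Continuous fun x => √(⟪f x, f x⟫ - 2 * ⟪f x, f a⟫ + ⟪f a, f a⟫) := by fun_prop
  have h4 : ∀ x, √(⟪f x, f x⟫ - 2 * ⟪f x, f a⟫ + ⟪f a, f a⟫) = ‖f x - f a‖ := by
    intro x
    rw [real_inner_self_eq_norm_sq, real_inner_self_eq_norm_sq, ← norm_sub_sq_real,
      Real.sqrt_sq (norm_nonneg _)]
  have h5 := h3.tendsto a
  simp only [h4] at h5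
  simpa using h5

lemma continuous_expField (hσ : 0 < σ) {X : Type*} [TopologicalSpace X] {a b : X → E d}
    (ha : Continuous a) (hb : Continuous b) : Continuous fun u => expField hσ (a u) (b u) := by
  refine continuous_of_continuous_inner ?_
  simp only [inner_expField]
  fun_prop

/-- The vector fields `expField` span a dense subspace. -/
lemma eq_zero_of_inner_expField (hσ : 0 < σ) {F : Lp (E d) 2 (gauss d σ)}
    (h : ∀ y v, ⟪F, expField hσ y v⟫ = 0) : F = 0 := by
  have hF := Lp.memLp F
  have hi : ∀ i, ∀ᵐ t ∂(gauss d σ), F t i = 0 := by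
    intro i
    have hFi : MemLp (fun t => F t i) 2 (gauss d σ) := by
      refine (hF.norm).mono ?_ (ae_of_all _ fun t => by simpa using PiLp.norm_apply_le (F t) i)
      exact (EuclideanSpace.proj i : E d →L[ℝ] ℝ).continuous.comp_aestronglyMeasurable hF.1
    refine ae_eq_zero_of_integral_mul_cameronMartin hσ hFi fun y => ?_
    have := h y (EuclideanSpace.single i 1)
    rw [← Lp.toLp_coeFn F hF, inner_toLp] at this
    simpa [EuclideanSpace.inner_single_right] using this
  rw [Lp.eq_zero_iff_ae_eq_zero]
  filter_upwards [ae_all_iff.2 hi] with t ht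
  ext i
  simpa using ht i

/-- The vector field `t ↦ (∫₀¹ E_{ux}(t) du) x`. It is the gradient of the representer of the
evaluation at `x` of the smoothed functions. -/
def kernelField (hσ : 0 < σ) (x : E d) : Lp (E d) 2 (gauss d σ) :=
  ∫ u in (0 : ℝ)..1, expField hσ (u • x) x

lemma continuous_expField_ray (hσ : 0 < σ) (y x : E d) :
    Continuous fun u : ℝ => expField hσ (y + u • x) x :=
  continuous_expField hσ (by fun_prop) (by fun_prop)

lemma continuous_kernelField (hσ : 0 < σ) : Continuous (kernelField (d := d) hσ) := by
  refine intervalIntegral.continuous_parametric_intervalIntegral_of_continuous' ?_ 0 1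
  exact continuous_expField hσ (by fun_prop) (by fun_prop)

lemma inner_kernelField (hσ : 0 < σ) (F : Lp (E d) 2 (gauss d σ)) (x : E d) :
    ⟪F, kernelField hσ x⟫ = ∫ u in (0 : ℝ)..1, ⟪F, expField hσ (u • x) x⟫ := by
  have hc : Continuous fun u : ℝ => expField hσ (u • x) x := by
    simpa using continuous_expField_ray hσ 0 x
  exact ((innerSL ℝ F).intervalIntegral_comp_comm (hc.intervalIntegrable 0 1)).symm

lemma integral_mul_exp_mul (s u : ℝ) (hu : u ≠ 0) :
    ∫ v in (0 : ℝ)..1, s * Real.exp (u * v * s) = (Real.exp (u * s) - 1) / u := by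
  have hd : ∀ v ∈ Set.uIcc (0 : ℝ) 1, HasDerivAt (fun v => Real.exp (u * v * s) / u)
      (s * Real.exp (u * v * s)) v := by
    intro v _
    have h1 : HasDerivAt (fun v : ℝ => u * v * s) (u * 1 * s) v :=
      ((hasDerivAt_id v).const_mul u).mul_const s
    refine (h1.exp.div_const u).congr_deriv ?_
    field_simp
  rw [intervalIntegral.integral_eq_sub_of_hasDerivAt hd
    (Continuous.intervalIntegrable (by fun_prop) _ _)]
  simp [sub_div]

lemma Ein_eq (z : ℝ) : Ein z = z * ∫ u in (0 : ℝ)..1, (1 - Real.exp (-(z * u))) / (z * u) := by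
  rcases eq_or_ne z 0 with rfl | hz
  · simp [Ein]
  · rw [intervalIntegral.integral_comp_mul_left (fun t => (1 - Real.exp (-t)) / t) hz, Ein]
    simp [hz]

lemma inner_kernelField_kernelField (hσ : 0 < σ) (x y : E d) :
    ⟪kernelField hσ x, kernelField hσ y⟫ = kernel d σ x y := by
  have h1 : ∀ v : ℝ, ⟪kernelField hσ x, expField hσ (v • y) y⟫
      = ∫ u in (0 : ℝ)..1, ⟪x, y⟫ * Real.exp (v * u * (⟪x, y⟫ / σ ^ 2)) := by
    intro v
    rw [real_inner_comm, inner_kernelField]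
    congr 1; ext u
    rw [inner_expField, real_inner_smul_left, real_inner_smul_right, real_inner_comm]
    congr 2; ring
  rw [inner_kernelField, kernel, Ein_eq, ← mul_assoc, ← intervalIntegral.integral_const_mul]
  refine intervalIntegral.integral_congr_ae ?_
  filter_upwards [Measure.ae_ne volume (0 : ℝ)] with v hv _
  have hs : ⟪x, y⟫ = σ ^ 2 * (⟪x, y⟫ / σ ^ 2) := by field_simp
  rw [h1]
  set s := ⟪x, y⟫ / σ ^ 2 with hs'
  have e : -⟪x, y⟫ / σ ^ 2 = -s := by rw [hs', neg_div]
  rw [e, hs]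
  simp only [mul_assoc (σ ^ 2)]
  rw [intervalIntegral.integral_const_mul, integral_mul_exp_mul s v hv]
  rcases eq_or_ne s 0 with h0 | h0
  · simp [h0]
  · field_simp
    ring_nf

/-! ### Increments of smoothed Sobolev functions -/

lemma memLp_of_contDiff {g : E d → ℝ} (hg : ContDiff ℝ ∞ g) (hc : HasCompactSupport g) :
    MemLp g 2 (gauss d σ) :=
  hg.continuous.memLp_of_hasCompactSupport hc

lemma hasCompactSupport_gradient {g : E d → ℝ} (hc : HasCompactSupport g) :
    HasCompactSupport (∇ g) :=
  (hc.fderiv ℝ).comp_left (g := (InnerProductSpace.toDual ℝ (E d)).symm) (map_zero _)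

lemma memLp_gradient {g : E d → ℝ} (hg : ContDiff ℝ ∞ g) (hc : HasCompactSupport g) :
    MemLp (∇ g) 2 (gauss d σ) :=
  (continuous_gradient hg).memLp_of_hasCompactSupport (hasCompactSupport_gradient hc)

lemma gradient_add_const (g : E d → ℝ) (a : ℝ) : ∇ (fun x => g x + a) = ∇ g := by
  funext x
  simp [gradient]

lemma inner_gradient (g : E d → ℝ) (x v : E d) : ⟪∇ g x, v⟫ = fderiv ℝ g x v := by
  simp [gradient, InnerProductSpace.toDual_symm_apply]

lemma memLp_test {u : E d → ℝ} (hu : u ∈ testFunctions d) : MemLp u 2 (gauss d σ) := by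
  obtain ⟨g, a, hg, hc, rfl⟩ := hu
  exact (memLp_of_contDiff hg hc).add (memLp_const a)

lemma memLp_gradient_test {u : E d → ℝ} (hu : u ∈ testFunctions d) :
    MemLp (∇ u) 2 (gauss d σ) := by
  obtain ⟨g, a, hg, hc, rfl⟩ := hu
  rw [gradient_add_const]
  exact memLp_gradient hg hc

lemma smooth_eq_inner (hσ : 0 < σ) {f : E d → ℝ} (hf : MemLp f 2 (gauss d σ)) (y : E d) :
    smooth σ f y = ⟪hf.toLp, (memLp_cameronMartin hσ y).toLp⟫ := by
  rw [L2.inner_def, smooth_apply hσ]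
  refine integral_congr_ae ?_
  filter_upwards [hf.coeFn_toLp, (memLp_cameronMartin hσ y).coeFn_toLp] with t h1 h2
  rw [h1, h2, RCLike.inner_apply, conj_trivial, mul_comm]

lemma smooth_add_const (hσ : 0 < σ) {f : E d → ℝ} (hf : MemLp f 2 (gauss d σ)) (a : ℝ) (y : E d) :
    smooth σ (fun x => f x + a) y = smooth σ f y + a := by
  rw [smooth_apply hσ, smooth_apply hσ]
  simp only [add_mul]
  have hi : Integrable (fun t => f t * cameronMartin σ y t) (gauss d σ) :=
    hf.integrable_mul (memLp_cameronMartin hσ y)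
  rw [integral_add hi ((integrable_cameronMartin hσ y).const_mul a), integral_const_mul,
    integral_cameronMartin hσ, mul_one]

lemma smooth_zero_eq_integral (hσ : 0 < σ) (f : E d → ℝ) :
    smooth σ f 0 = ∫ x, f x ∂(gauss d σ) := by
  simp [smooth_apply hσ]

lemma hasFDerivAt_smooth (hσ : 0 < σ) {g : E d → ℝ} (hg : ContDiff ℝ ∞ g)
    (hc : HasCompactSupport g) (y : E d) :
    ∃ D : E d →L[ℝ] ℝ, HasFDerivAt (smooth σ g) D y ∧
      ∀ v, D v = ⟪(memLp_gradient hg hc).toLp, expField hσ y v⟫ := by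
  have hli : LocallyIntegrable (gaussDensity d σ) volume :=
    (continuous_gaussDensity d σ).locallyIntegrable
  have hg1 : ContDiff ℝ 1 g := hg.of_le (by exact_mod_cast le_top)
  refine ⟨_, hc.hasFDerivAt_convolution_left (ContinuousLinearMap.mul ℝ ℝ) hg1 hli y, fun v => ?_⟩
  rw [inner_toLp, integral_gauss hσ, convolution, ContinuousLinearMap.integral_apply]
  · refine integral_congr_ae (ae_of_all _ fun t => ?_)
    simp only [inner_gradient, gaussDensity_sub hσ, smul_eq_mul]
    simp only [ContinuousLinearMap.precompL_apply, ContinuousLinearMap.mul_apply']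
    ring
  · exact (hc.fderiv ℝ).convolutionExists_left _ (hg1.continuous_fderiv one_ne_zero) hli y

lemma smooth_sub_test (hσ : 0 < σ) {u : E d → ℝ} (hu : u ∈ testFunctions d) (x v : E d) :
    smooth σ u (x + v) - smooth σ u x = ∫ s in (0 : ℝ)..1,
      ⟪(memLp_gradient_test hu).toLp, expField hσ (x + s • v) v⟫ := by
  have hu' := hu
  obtain ⟨g, a, hg, hc, rfl⟩ := hu
  have hd : ∀ s : ℝ, HasDerivAt (fun s : ℝ => smooth σ g (x + s • v))
      ⟪(memLp_gradient_test hu').toLp, expField hσ (x + s • v) v⟫ s := by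
    intro s
    obtain ⟨D, hD, hDv⟩ := hasFDerivAt_smooth hσ hg hc (x + s • v)
    have hl : HasDerivAt (fun s : ℝ => x + s • v) v s := by
      simpa using ((hasDerivAt_id s).smul_const v).const_add x
    refine (hD.comp_hasDerivAt s hl).congr_deriv ?_
    rw [hDv]
    simp only [gradient_add_const]
  rw [intervalIntegral.integral_eq_sub_of_hasDerivAt (fun s _ => hd s)]
  · simp only [smooth_add_const hσ (memLp_of_contDiff hg hc)]
    simp
  · exact (Continuous.inner continuous_const
      (continuous_expField_ray hσ x v)).intervalIntegrable _ _

lemma integral_inner_expField (hσ : 0 < σ) (F : Lp (E d) 2 (gauss d σ)) (x v : E d) :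
    ∫ s in (0 : ℝ)..1, ⟪F, expField hσ (x + s • v) v⟫
      = ⟪F, ∫ s in (0 : ℝ)..1, expField hσ (x + s • v) v⟫ :=
  (innerSL ℝ F).intervalIntegral_comp_comm
    ((continuous_expField_ray hσ x v).intervalIntegrable 0 1)

/-- The fundamental theorem of calculus along a segment for smoothed Sobolev functions. -/
lemma MemSobolev.smooth_sub (hσ : 0 < σ) {f : E d → ℝ} {F : E d → E d}
    (hf : MemSobolev (gauss d σ) f F) (x v : E d) :
    smooth σ f (x + v) - smooth σ f x = ∫ s in (0 : ℝ)..1,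
      ⟪hf.memLp_grad.toLp, expField hσ (x + s • v) v⟫ := by
  obtain ⟨u, hu, h1, h2⟩ := hf.exists_seq
  have t1 := (Lp.tendsto_Lp_iff_tendsto_eLpNorm'' u (fun n => memLp_test (hu n)) f hf.memLp).2 h1
  have t2 := (Lp.tendsto_Lp_iff_tendsto_eLpNorm'' _ (fun n => memLp_gradient_test (hu n)) F
    hf.memLp_grad).2 h2
  have hs : ∀ y, Tendsto (fun n => smooth σ (u n) y) atTop (𝓝 (smooth σ f y)) := by
    intro y
    simp only [smooth_eq_inner hσ (memLp_test (hu _)), smooth_eq_inner hσ hf.memLp]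
    exact t1.inner tendsto_const_nhds
  refine tendsto_nhds_unique ((hs (x + v)).sub (hs x)) ?_
  simp only [smooth_sub_test hσ (hu _), integral_inner_expField]
  exact t2.inner tendsto_const_nhds

/-- A mean-zero Sobolev function with gradient `F` smooths to `x ↦ ⟪F, kernelField x⟫`. -/
lemma MemSobolevZero.smooth_eq (hσ : 0 < σ) {f : E d → ℝ} {F : E d → E d}
    (hf : MemSobolevZero (gauss d σ) f F) (x : E d) :
    smooth σ f x = ⟪hf.memLp_grad.toLp, kernelField hσ x⟫ := by
  have h := hf.toMemSobolev.smooth_sub hσ 0 x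
  rw [smooth_zero_eq_integral hσ, hf.mean_zero] at h
  rw [inner_kernelField]
  simpa using h

/-- The gradient of a Sobolev function is determined by the smoothed function: differentiating
along every ray shows that it is orthogonal to every `expField`. -/
lemma MemSobolev.grad_eq_zero (hσ : 0 < σ) {f : E d → ℝ} {F : E d → E d}
    (hf : MemSobolev (gauss d σ) f F) (h0 : smooth σ f = 0) : hf.memLp_grad.toLp = 0 := by
  refine eq_zero_of_inner_expField hσ fun x v => ?_
  set P := hf.memLp_grad.toLp
  have hc : Continuous fun s : ℝ => ⟪P, expField hσ (x + s • v) v⟫ :=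
    Continuous.inner continuous_const (continuous_expField_ray hσ x v)
  have hz : ∀ r : ℝ, ∫ s in (0 : ℝ)..r, ⟪P, expField hσ (x + s • v) v⟫ = 0 := by
    intro r
    have h := hf.smooth_sub hσ x (r • v)
    simp only [h0, Pi.zero_apply, sub_zero, expField_smul, inner_smul_right, smul_smul,
      intervalIntegral.integral_const_mul] at h
    have h2 := intervalIntegral.mul_integral_comp_mul_right (a := 0) (b := 1)
      (f := fun s : ℝ => ⟪P, expField hσ (x + s • v) v⟫) r
    rw [zero_mul, one_mul] at h2
    exact h2.symm.trans h.symm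
  have hd := intervalIntegral.integral_hasDerivAt_right (hc.intervalIntegrable 0 0)
    (hc.stronglyMeasurableAtFilter _ _) hc.continuousAt
  simp only [hz] at hd
  simpa using hd.unique (hasDerivAt_const 0 0)

/-! ### A Gaussian Poincaré inequality -/

lemma map_rotation_gauss (θ : ℝ) :
    ((gauss d σ).prod (gauss d σ)).map (ContinuousLinearMap.rotation θ)
      = (gauss d σ).prod (gauss d σ) := by
  have : ProbabilityTheory.IsGaussian (gauss d σ) := by unfold gauss; infer_instance
  refine ProbabilityTheory.IsGaussian.map_rotation_eq_self ?_ θ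
  simp [gauss]

lemma memLp_id_gauss : MemLp id 2 (gauss d σ) := by
  have : ProbabilityTheory.IsGaussian (gauss d σ) := by unfold gauss; infer_instance
  exact ProbabilityTheory.IsGaussian.memLp_id _ 2 (by simp)

/-- The Cauchy–Schwarz inequality on `[0, a]` for the increment of a `C¹` function. -/
lemma sq_sub_le_integral {φ ψ : ℝ → ℝ} (hd : ∀ θ, HasDerivAt φ (ψ θ) θ) (hψ : Continuous ψ)
    {a : ℝ} (ha : 0 ≤ a) : (φ a - φ 0) ^ 2 ≤ a * ∫ θ in (0 : ℝ)..a, ψ θ ^ 2 := by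
  have hi := hψ.intervalIntegrable (μ := volume) 0 a
  have hi2 : IntervalIntegrable (fun θ => ψ θ ^ 2) volume 0 a := (hψ.pow 2).intervalIntegrable 0 a
  rw [← intervalIntegral.integral_eq_sub_of_hasDerivAt (fun θ _ => hd θ) hi]
  set m := ∫ θ in (0 : ℝ)..a, ψ θ
  -- expand `0 ≤ ∫ (a ψ - m)²`
  have h0 : 0 ≤ ∫ θ in (0 : ℝ)..a, (a * ψ θ - m) ^ 2 :=
    intervalIntegral.integral_nonneg ha fun _ _ => sq_nonneg _
  have h1 : ∫ θ in (0 : ℝ)..a, (a * ψ θ - m) ^ 2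
      = a * (a * (∫ θ in (0 : ℝ)..a, ψ θ ^ 2) - m ^ 2) := by
    have e : ∀ θ, (a * ψ θ - m) ^ 2 = a ^ 2 * ψ θ ^ 2 - 2 * a * m * ψ θ + m ^ 2 := by
      intro θ; ring
    simp only [e]
    rw [intervalIntegral.integral_add ((hi2.const_mul _).sub (hi.const_mul _))
        intervalIntegrable_const,
      intervalIntegral.integral_sub (hi2.const_mul _) (hi.const_mul _),
      intervalIntegral.integral_const_mul, intervalIntegral.integral_const_mul]
    simp only [intervalIntegral.integral_const, smul_eq_mul]
    ring
  rcases ha.eq_or_lt with rfl | ha'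
  · simp [m]
  · rw [h1] at h0
    linarith [nonneg_of_mul_nonneg_right h0 ha']

/-- For independent `X, Y` the curve `cos θ X + sin θ Y` joins `X` to `Y`, and by rotation
invariance it is at each time independent of its velocity. -/
lemma lintegral_sq_sub_le {g : E d → ℝ} (hg : ContDiff ℝ ∞ g) :
    ∫⁻ p, ENNReal.ofReal ((g p.2 - g p.1) ^ 2) ∂((gauss d σ).prod (gauss d σ))
      ≤ ENNReal.ofReal (Real.pi / 2) * ENNReal.ofReal (Real.pi / 2) *
        ((∫⁻ x, ‖∇ g x‖ₑ ^ 2 ∂(gauss d σ)) * ∫⁻ x, ‖x‖ₑ ^ 2 ∂(gauss d σ)) := by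
  set γ := gauss d σ
  have hpi : (0 : ℝ) ≤ Real.pi / 2 := by positivity
  obtain ⟨q, hq⟩ : ∃ q : E d × E d → ℝ, q = fun p => ⟪∇ g p.1, p.2⟫ ^ 2 := ⟨_, rfl⟩
  have hgc := continuous_gradient hg
  have hqc : Continuous q := by rw [hq]; fun_prop
  have hqr : Continuous fun z : ℝ × (E d × E d) =>
      q (ContinuousLinearMap.rotation z.1 z.2) := by
    simp only [hq, ContinuousLinearMap.rotation_apply]
    fun_prop
  have hmeas : Measurable fun z : ℝ × (E d × E d) =>
      ENNReal.ofReal (q (ContinuousLinearMap.rotation z.1 z.2)) :=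
    hqr.measurable.ennreal_ofReal
  have hpt : ∀ p : E d × E d, ENNReal.ofReal ((g p.2 - g p.1) ^ 2)
      ≤ ENNReal.ofReal (Real.pi / 2) * ∫⁻ θ in Set.Ioc 0 (Real.pi / 2),
        ENNReal.ofReal (q (ContinuousLinearMap.rotation θ p)) := by
    intro p
    have hc1 : Continuous fun θ => q (ContinuousLinearMap.rotation θ p) := by
      simp only [hq, ContinuousLinearMap.rotation_apply]
      fun_prop
    rw [← ofReal_integral_eq_lintegral_ofReal
      (hc1.integrableOn_Icc.mono_set Set.Ioc_subset_Icc_self)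
      (ae_of_all _ fun θ => by simp only [hq, Pi.zero_apply]; positivity),
      ← ENNReal.ofReal_mul hpi,
      ← intervalIntegral.integral_of_le hpi]
    refine ENNReal.ofReal_le_ofReal ?_
    have hd : ∀ θ : ℝ, HasDerivAt (fun θ : ℝ => g (Real.cos θ • p.1 + Real.sin θ • p.2))
        ⟪∇ g (Real.cos θ • p.1 + Real.sin θ • p.2), -Real.sin θ • p.1 + Real.cos θ • p.2⟫ θ := by
      intro θ
      rw [inner_gradient]
      exact (hg.differentiable (by simp) _).hasFDerivAt.comp_hasDerivAt θ
        (((Real.hasDerivAt_cos θ).smul_const p.1).add ((Real.hasDerivAt_sin θ).smul_const p.2))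
    have h := sq_sub_le_integral hd (by fun_prop) hpi
    simpa [hq, ContinuousLinearMap.rotation_apply] using h
  calc _ ≤ ∫⁻ p, ENNReal.ofReal (Real.pi / 2) * (∫⁻ θ in Set.Ioc 0 (Real.pi / 2),
        ENNReal.ofReal (q (ContinuousLinearMap.rotation θ p))) ∂(γ.prod γ) := lintegral_mono hpt
    _ = ENNReal.ofReal (Real.pi / 2) * ∫⁻ θ in Set.Ioc 0 (Real.pi / 2),
        ∫⁻ p, ENNReal.ofReal (q (ContinuousLinearMap.rotation θ p)) ∂(γ.prod γ) := by
      rw [lintegral_const_mul' _ _ (by simp), lintegral_lintegral_swap]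
      exact (hmeas.comp measurable_swap).aemeasurable
    _ = ENNReal.ofReal (Real.pi / 2) * ∫⁻ θ in Set.Ioc 0 (Real.pi / 2),
        ∫⁻ p, ENNReal.ofReal (q p) ∂(γ.prod γ) := by
      congr 2; ext θ
      conv_rhs => rw [← map_rotation_gauss θ]
      rw [lintegral_map hqc.measurable.ennreal_ofReal
        (ContinuousLinearMap.rotation θ).continuous.measurable]
    _ ≤ _ := by
      rw [lintegral_const, Measure.restrict_apply_univ, Real.volume_Ioc, sub_zero,
        mul_comm (∫⁻ _, _ ∂_), ← mul_assoc]
      gcongr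
      rw [← lintegral_prod_mul
        ((continuous_gradient hg).enorm.measurable.pow_const 2).aemeasurable
        (continuous_enorm.measurable.pow_const 2).aemeasurable]
      refine lintegral_mono fun p => ?_
      rw [← mul_pow, ← enorm_norm (∇ g p.1), ← enorm_norm p.2, ← enorm_mul,
        Real.enorm_of_nonneg (by positivity), ← ENNReal.ofReal_pow (by positivity)]
      refine ENNReal.ofReal_le_ofReal ?_
      rw [hq, sq_le_sq, abs_of_nonneg (by positivity : 0 ≤ ‖∇ g p.1‖ * ‖p.2‖)]
      exact abs_real_inner_le_norm _ _

lemma norm_toLp_sq {V : Type*} [NormedAddCommGroup V] [InnerProductSpace ℝ V] {γ : Measure (E d)}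
    {f : E d → V} (hf : MemLp f 2 γ) : ‖hf.toLp‖ ^ 2 = ∫ x, ‖f x‖ ^ 2 ∂γ := by
  rw [← real_inner_self_eq_norm_sq, L2.inner_def]
  refine integral_congr_ae ?_
  filter_upwards [hf.coeFn_toLp] with t h1
  rw [h1, real_inner_self_eq_norm_sq]

lemma lintegral_enorm_sq {V : Type*} [NormedAddCommGroup V] {γ : Measure (E d)}
    {f : E d → V} (hf : MemLp f 2 γ) :
    ∫⁻ x, ‖f x‖ₑ ^ 2 ∂γ = ENNReal.ofReal (∫ x, ‖f x‖ ^ 2 ∂γ) := by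
  rw [ofReal_integral_eq_lintegral_ofReal (hf.integrable_norm_pow two_ne_zero)
    (ae_of_all _ fun x => by positivity)]
  congr 1; ext x
  rw [ENNReal.ofReal_pow (norm_nonneg _), ofReal_norm]

/-- The Gaussian Poincaré inequality, with a constant that is not optimal. -/
lemma exists_poincare (d : ℕ) (σ : ℝ) : ∃ C : ℝ, ∀ (g : E d → ℝ) (hg : ContDiff ℝ ∞ g)
    (hc : HasCompactSupport g),
    ‖((memLp_of_contDiff (σ := σ) hg hc).sub (memLp_const (∫ x, g x ∂(gauss d σ)))).toLp‖
      ≤ C * ‖(memLp_gradient (σ := σ) hg hc).toLp‖ := by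
  set γ := gauss d σ
  set M := ∫ x : E d, ‖x‖ ^ 2 ∂γ
  have hM0 : 0 ≤ M := integral_nonneg fun _ => by positivity
  refine ⟨√((Real.pi / 2) ^ 2 * M), fun g hg hc => ?_⟩
  set m := ∫ x, g x ∂γ with hm
  have hgL : MemLp g 2 γ := memLp_of_contDiff hg hc
  have hh : MemLp (fun x => g x - m) 2 γ := hgL.sub (memLp_const m)
  have hh1 : Integrable (fun x => g x - m) γ := hh.integrable (by simp)
  have hh2 : Integrable (fun x => (g x - m) ^ 2) γ := hh.integrable_sq
  have hmean : ∫ x, (g x - m) ∂γ = 0 := by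
    rw [integral_sub (hgL.integrable (by simp)) (integrable_const m)]
    simp [hm]
  -- twice the variance of `g` is the mean square of the difference of two independent copies
  have e : ∀ p : E d × E d, (g p.2 - g p.1) ^ 2
      = (g p.1 - m) ^ 2 - 2 * ((g p.1 - m) * (g p.2 - m)) + (g p.2 - m) ^ 2 := fun p => by ring
  have i1 : Integrable (fun p : E d × E d => (g p.1 - m) ^ 2) (γ.prod γ) := hh2.comp_fst γ
  have i2 : Integrable (fun p : E d × E d => (g p.2 - m) ^ 2) (γ.prod γ) := hh2.comp_snd γ
  have i3 : Integrable (fun p : E d × E d => (g p.1 - m) * (g p.2 - m)) (γ.prod γ) :=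
    hh1.mul_prod hh1
  have hint : Integrable (fun p : E d × E d => (g p.2 - g p.1) ^ 2) (γ.prod γ) := by
    simp only [e]
    exact (i1.sub (i3.const_mul 2)).add i2
  have hval : ∫ p, (g p.2 - g p.1) ^ 2 ∂(γ.prod γ) = 2 * ∫ x, (g x - m) ^ 2 ∂γ := by
    simp only [e]
    have i4 : Integrable (fun p : E d × E d => (g p.1 - m) ^ 2 - 2 * ((g p.1 - m) * (g p.2 - m)))
      (γ.prod γ) := i1.sub (i3.const_mul 2)
    rw [integral_add i4 i2, integral_sub i1 (i3.const_mul 2),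
      integral_const_mul, integral_prod_mul (fun x => g x - m) (fun x => g x - m), hmean,
      integral_fun_fst (fun x => (g x - m) ^ 2), integral_fun_snd (fun x => (g x - m) ^ 2)]
    simp
    ring
  have h := lintegral_sq_sub_le (σ := σ) hg
  rw [← ofReal_integral_eq_lintegral_ofReal hint (ae_of_all _ fun _ => sq_nonneg _), hval,
    lintegral_enorm_sq (memLp_gradient hg hc), lintegral_enorm_sq (f := fun x => x) memLp_id_gauss,
    ← norm_toLp_sq (memLp_gradient hg hc), ← ENNReal.ofReal_mul (by positivity),
    ← ENNReal.ofReal_mul (by positivity), ← ENNReal.ofReal_mul (by positivity),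
    ENNReal.ofReal_le_ofReal_iff (by positivity)] at h
  refine abs_le_of_sq_le_sq' ?_ (by positivity) |>.2
  rw [norm_toLp_sq, mul_pow, Real.sq_sqrt (by positivity)]
  simp only [Pi.sub_apply, Real.norm_eq_abs, sq_abs]
  have h0 : 0 ≤ ∫ x, (g x - m) ^ 2 ∂γ := integral_nonneg fun _ => sq_nonneg _
  calc _ ≤ 2 * ∫ x, (g x - m) ^ 2 ∂γ := by linarith
    _ ≤ _ := h
    _ = _ := by ring

/-! ### The Hilbert space of Sobolev gradients -/

/-- The gradients of compactly supported smooth functions, in `L²(N_σ; ℝ^d)`. -/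
def testGradients (d : ℕ) (σ : ℝ) : Submodule ℝ (Lp (E d) 2 (gauss d σ)) where
  carrier := {F | ∃ (g : E d → ℝ) (hg : ContDiff ℝ ∞ g) (hc : HasCompactSupport g),
    F = (memLp_gradient hg hc).toLp}
  zero_mem' := by
    refine ⟨0, contDiff_const, HasCompactSupport.zero, ?_⟩
    have h : ∇ (0 : E d → ℝ) = 0 := gradient_const' (0 : ℝ)
    simp only [h]
    exact (MemLp.toLp_zero _).symm
  add_mem' := by
    rintro _ _ ⟨g, hg, hc, rfl⟩ ⟨h, hh, hk, rfl⟩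
    refine ⟨g + h, hg.add hh, hc.add hk, ?_⟩
    rw [← MemLp.toLp_add]
    simp only [gradient_add' hg hh]
  smul_mem' := by
    rintro c _ ⟨g, hg, hc, rfl⟩
    refine ⟨c • g, contDiff_const.smul hg, hc.smul_left (f := fun _ => c), ?_⟩
    rw [← MemLp.toLp_const_smul]
    simp only [gradient_smul' c hg]

/-- The closed subspace of `L²(N_σ; ℝ^d)` formed by the gradients of Sobolev functions. -/
def gradientSpace (d : ℕ) (σ : ℝ) : Submodule ℝ (Lp (E d) 2 (gauss d σ)) :=
  (testGradients d σ).topologicalClosure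

lemma isClosed_gradientSpace : IsClosed (gradientSpace d σ : Set (Lp (E d) 2 (gauss d σ))) :=
  Submodule.isClosed_topologicalClosure _

lemma toLp_gradient_mem {g : E d → ℝ} (hg : ContDiff ℝ ∞ g) (hc : HasCompactSupport g) :
    (memLp_gradient hg hc).toLp ∈ gradientSpace d σ :=
  Submodule.le_topologicalClosure _ ⟨g, hg, hc, rfl⟩

lemma MemSobolev.toLp_mem {f : E d → ℝ} {F : E d → E d} (hf : MemSobolev (gauss d σ) f F) :
    hf.memLp_grad.toLp ∈ gradientSpace d σ := by
  obtain ⟨u, hu, -, h2⟩ := hf.exists_seq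
  have t2 := (Lp.tendsto_Lp_iff_tendsto_eLpNorm'' _ (fun n => memLp_gradient_test (hu n)) F
    hf.memLp_grad).2 h2
  refine isClosed_gradientSpace.mem_of_tendsto t2 (Eventually.of_forall fun n => ?_)
  obtain ⟨g, a, hg, hc, he⟩ := hu n
  simp only [he, gradient_add_const]
  exact toLp_gradient_mem hg hc

/-- Every element of the gradient space is the gradient of a mean-zero Sobolev function: by the
Poincaré inequality the primitives of a convergent sequence of gradients converge. -/
lemma exists_memSobolevZero (hσ : 0 < σ) {F : Lp (E d) 2 (gauss d σ)}
    (hF : F ∈ gradientSpace d σ) : ∃ f, MemSobolevZero (gauss d σ) f F := by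
  obtain ⟨C, hC⟩ := exists_poincare d σ
  obtain ⟨Fn, hFn, hlim⟩ := mem_closure_iff_seq_limit.1 hF
  choose g hg hc he using hFn
  set m : ℕ → ℝ := fun n => ∫ x, g n x ∂(gauss d σ) with hm
  set u : ℕ → E d → ℝ := fun n x => g n x + -m n with hu
  have hut : ∀ n, u n ∈ testFunctions d := fun n => ⟨g n, -m n, hg n, hc n, rfl⟩
  have hgrad : ∀ n, ∇ (u n) = ∇ (g n) := fun n => gradient_add_const _ _
  have hFe : ∀ n, Fn n = (memLp_gradient_test (hut n)).toLp := by
    intro n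
    rw [he n]
    simp only [hgrad]
  set U : ℕ → Lp ℝ 2 (gauss d σ) := fun n => (memLp_test (hut n)).toLp
  have hdist : ∀ n k, dist (U n) (U k) ≤ C * dist (Fn n) (Fn k) := by
    intro n k
    have hck : HasCompactSupport (g n - g k) := by
      simpa [sub_eq_add_neg] using (hc n).add (hc k).neg
    have h := hC (g n - g k) ((hg n).sub (hg k)) hck
    have hi : ∀ n, Integrable (g n) (gauss d σ) := fun n =>
      (memLp_of_contDiff (hg n) (hc n)).integrable (by simp)
    have e1 : (g n - g k) - (fun _ => ∫ x, (g n - g k) x ∂(gauss d σ)) = u n - u k := by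
      funext x
      simp only [Pi.sub_apply, hu, hm]
      rw [integral_sub (hi n) (hi k)]
      ring
    have hk : ContDiff ℝ ∞ ((-1 : ℝ) • g k) := contDiff_const.smul (hg k)
    have e2 : ∇ (g n - g k) = ∇ (g n) - ∇ (g k) := by
      rw [sub_eq_add_neg, ← neg_one_smul ℝ (g k),
        gradient_add' (hg n) hk, gradient_smul' _ (hg k),
        neg_one_smul, ← sub_eq_add_neg]
    simp only [e1, e2] at h
    rw [MemLp.toLp_sub (memLp_test (hut n)) (memLp_test (hut k)),
      MemLp.toLp_sub (memLp_gradient (hg n) (hc n)) (memLp_gradient (hg k) (hc k)),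
      ← he, ← he] at h
    rwa [dist_eq_norm, dist_eq_norm]
  have hcau : CauchySeq U := by
    rw [cauchySeq_iff_tendsto_dist_atTop_0]
    have h1 := (cauchySeq_iff_tendsto_dist_atTop_0.1 hlim.cauchySeq).const_mul C
    rw [mul_zero] at h1
    exact squeeze_zero (fun _ => dist_nonneg) (fun n => hdist n.1 n.2) h1
  obtain ⟨f, hf⟩ := cauchySeq_tendsto_of_complete hcau
  have hfL := Lp.memLp f
  have hFL := Lp.memLp F
  have hf' : Tendsto U atTop (𝓝 hfL.toLp) := by rwa [Lp.toLp_coeFn]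
  refine ⟨f, ⟨hfL, hFL, u, hut, ?_, ?_⟩, ?_⟩
  · exact (Lp.tendsto_Lp_iff_tendsto_eLpNorm'' u (fun n => memLp_test (hut n)) f hfL).1 hf'
  · refine (Lp.tendsto_Lp_iff_tendsto_eLpNorm'' _ (fun n => memLp_gradient_test (hut n)) F
      hFL).1 ?_
    rw [Lp.toLp_coeFn]
    simpa only [← hFe] using hlim
  · have h1 : Tendsto (fun n => smooth σ (u n) 0) atTop (𝓝 (smooth σ f 0)) := by
      simp only [smooth_eq_inner hσ (memLp_test (hut _)), smooth_eq_inner hσ hfL]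
      exact hf'.inner tendsto_const_nhds
    rw [smooth_zero_eq_integral hσ] at h1
    refine tendsto_nhds_unique h1 ?_
    have h2 : ∀ n, smooth σ (u n) 0 = 0 := by
      intro n
      rw [smooth_add_const hσ (memLp_of_contDiff (hg n) (hc n)), smooth_zero_eq_integral hσ]
      simp [hm]
    simp only [h2]
    exact tendsto_const_nhds

/-! ### The kernel fields are gradients -/

lemma hasFDerivAt_cameronMartin (y t : E d) :
    HasFDerivAt (cameronMartin σ y) ((cameronMartin σ y t / σ ^ 2) • innerSL ℝ y) t := by
  have h1 : HasFDerivAt (fun t : E d => ⟪y, t⟫) (innerSL ℝ y) t := (innerSL ℝ y).hasFDerivAt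
  have h2 := ((h1.mul_const ((σ ^ 2)⁻¹)).sub_const (‖y‖ ^ 2 / (2 * σ ^ 2))).exp
  simp only [← div_eq_mul_inv] at h2
  refine h2.congr_fderiv ?_
  ext w
  simp [cameronMartin]
  ring

lemma contDiff_cameronMartin (y : E d) : ContDiff ℝ ∞ (cameronMartin σ y) := by
  have h : ContDiff ℝ ∞ fun t : E d => ⟪y, t⟫ := contDiff_const.inner ℝ contDiff_id
  exact ((h.div_const _).sub contDiff_const).exp

lemma exists_cutoff (d : ℕ) : ∃ χ : E d → ℝ, ContDiff ℝ ∞ χ ∧ HasCompactSupport χ ∧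
    (∀ t, ‖χ t‖ ≤ 1) ∧ χ 0 = 1 := by
  let χ : ContDiffBump (0 : E d) := ⟨1, 2, one_pos, one_lt_two⟩
  refine ⟨χ, χ.contDiff, χ.hasCompactSupport, fun t => ?_, χ.one_of_mem_closedBall (by simp [χ])⟩
  rw [Real.norm_of_nonneg χ.nonneg]
  exact χ.le_one

lemma inner_gradient_cutoff {χ : E d → ℝ} (hχ : ContDiff ℝ ∞ χ) (r : ℝ) (y t w : E d) :
    ⟪∇ (fun t => χ (r • t) * cameronMartin σ y t) t, w⟫
      = χ (r • t) * (cameronMartin σ y t / σ ^ 2 * ⟪y, w⟫)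
        + cameronMartin σ y t * (r * fderiv ℝ χ (r • t) w) := by
  have h1 : HasFDerivAt (fun t : E d => χ (r • t))
      ((fderiv ℝ χ (r • t)).comp (r • ContinuousLinearMap.id ℝ (E d))) t :=
    (hχ.differentiable (by simp) _).hasFDerivAt.comp t ((hasFDerivAt_id t).const_smul r)
  have h2 : HasFDerivAt (fun t => χ (r • t) * cameronMartin σ y t) _ t :=
    h1.mul (hasFDerivAt_cameronMartin y t)
  rw [inner_gradient, h2.fderiv]
  simp

/-- A field orthogonal to the gradients of compactly supported functions is orthogonal to the
gradient `σ⁻² E_y y` of the Cameron–Martin density, a limit of the gradients of its cutoffs. -/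
lemma inner_expField_self_eq_zero (hσ : 0 < σ) {P : Lp (E d) 2 (gauss d σ)}
    (hP : ∀ F ∈ gradientSpace d σ, ⟪F, P⟫ = 0) (y : E d) : ⟪P, expField hσ y y⟫ = 0 := by
  obtain ⟨χ, hχ, hχc, hχb, hχ1⟩ := exists_cutoff d
  obtain ⟨C, hC⟩ := (hχc.fderiv ℝ).exists_bound_of_continuous
    (hχ.continuous_fderiv (by simp))
  have hC0 : 0 ≤ C := (norm_nonneg _).trans (hC 0)
  set r : ℕ → ℝ := fun n => 1 / ((n : ℝ) + 1) with hr
  have hr0 : ∀ n, 0 < r n := fun n => Nat.one_div_pos_of_nat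
  have hr1 : ∀ n, r n ≤ 1 := fun n => by
    rw [hr, div_le_one (by positivity)]; linarith [n.cast_nonneg (α := ℝ)]
  have hrt : Tendsto r atTop (𝓝 0) := tendsto_one_div_add_atTop_nhds_zero_nat
  obtain ⟨g, hgdef⟩ : ∃ g : ℕ → E d → ℝ, g = fun n t => χ (r n • t) * cameronMartin σ y t :=
    ⟨_, rfl⟩
  have hg : ∀ n, ContDiff ℝ ∞ (g n) := fun n => by
    rw [hgdef]
    exact (hχ.comp (contDiff_id.const_smul (r n))).mul (contDiff_cameronMartin y)
  have hc : ∀ n, HasCompactSupport (g n) := fun n => by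
    rw [hgdef]
    exact (hχc.comp_smul (hr0 n).ne').mul_right
  have hder : ∀ n t w, ⟪∇ (g n) t, w⟫ = χ (r n • t) * (cameronMartin σ y t / σ ^ 2 * ⟪y, w⟫)
      + cameronMartin σ y t * (r n * fderiv ℝ χ (r n • t) w) := fun n t w => by
    rw [hgdef]
    exact inner_gradient_cutoff hχ (r n) y t w
  have hPL := Lp.memLp P
  have hzero : ∀ n, ∫ t, ⟪∇ (g n) t, P t⟫ ∂(gauss d σ) = 0 := by
    intro n
    rw [← hP _ (toLp_gradient_mem (hg n) (hc n)), L2.inner_def]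
    refine integral_congr_ae ?_
    filter_upwards [(memLp_gradient (σ := σ) (hg n) (hc n)).coeFn_toLp] with t h1
    rw [h1]
  have hlim : Tendsto (fun n => ∫ t, ⟪∇ (g n) t, P t⟫ ∂(gauss d σ)) atTop
      (𝓝 (∫ t, cameronMartin σ y t / σ ^ 2 * ⟪y, P t⟫ ∂(gauss d σ))) := by
    refine tendsto_integral_of_dominated_convergence
      (fun t => (‖y‖ / σ ^ 2 + C) * (‖P t‖ * cameronMartin σ y t)) (fun n => ?_) ?_
      (fun n => ae_of_all _ fun t => ?_) (ae_of_all _ fun t => ?_)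
    · exact (continuous_gradient (hg n)).aestronglyMeasurable.inner hPL.1
    · exact (hPL.norm.integrable_mul (memLp_cameronMartin hσ y)).const_mul _
    · have hE := cameronMartin_pos (σ := σ) y t
      have hb : ‖fderiv ℝ χ (r n • t) (P t)‖ ≤ C * ‖P t‖ :=
        ((fderiv ℝ χ (r n • t)).le_opNorm _).trans (by gcongr; exact hC _)
      rw [hder]
      refine (norm_add_le _ _).trans ?_
      simp only [norm_mul, norm_div, norm_pow, Real.norm_of_nonneg hE.le, Real.norm_of_nonneg hσ.le,
        Real.norm_of_nonneg (hr0 n).le]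
      have hin : ‖⟪y, P t⟫‖ ≤ ‖y‖ * ‖P t‖ := norm_inner_le_norm _ _
      calc _ ≤ 1 * (cameronMartin σ y t / σ ^ 2 * (‖y‖ * ‖P t‖))
            + cameronMartin σ y t * (1 * (C * ‖P t‖)) := by
              gcongr
              · exact hχb _
              · exact hr1 n
        _ = _ := by ring
    · simp only [hder]
      have h1 : Tendsto (fun n => r n • t) atTop (𝓝 0) := by simpa using hrt.smul_const t
      have h2 : Tendsto (fun n => χ (r n • t)) atTop (𝓝 1) := by
        have := (hχ.continuous.tendsto 0).comp h1
        rwa [hχ1] at this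
      have h3 : Tendsto (fun n => fderiv ℝ χ (r n • t) (P t)) atTop (𝓝 (fderiv ℝ χ 0 (P t))) :=
        (((hχ.continuous_fderiv (by simp)).clm_apply continuous_const).tendsto 0).comp h1
      simpa using (h2.mul_const _).add ((hrt.mul h3).const_mul (cameronMartin σ y t))
  simp only [hzero] at hlim
  have h0 := tendsto_nhds_unique hlim tendsto_const_nhds
  have e : ∀ t, cameronMartin σ y t / σ ^ 2 * ⟪y, P t⟫
      = (σ ^ 2)⁻¹ * (⟪P t, y⟫ * cameronMartin σ y t) := by
    intro t; rw [real_inner_comm]; ring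
  simp only [e] at h0
  rw [integral_const_mul] at h0
  rw [← Lp.toLp_coeFn P hPL, inner_toLp]
  exact (mul_eq_zero.1 h0).resolve_left (by positivity)

lemma kernelField_mem (hσ : 0 < σ) (x : E d) : kernelField hσ x ∈ gradientSpace d σ := by
  have : (gradientSpace d σ)ᗮᗮ = gradientSpace d σ := by
    rw [Submodule.orthogonal_orthogonal_eq_closure, gradientSpace]
    exact isClosed_gradientSpace.submodule_topologicalClosure_eq
  rw [← this, Submodule.mem_orthogonal]
  intro P hP
  rw [Submodule.mem_orthogonal] at hP
  rw [inner_kernelField]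
  refine intervalIntegral.integral_zero_ae ?_
  filter_upwards [Measure.ae_ne volume (0 : ℝ)] with u hu _
  have h := inner_expField_self_eq_zero hσ hP (u • x)
  rw [expField_smul, inner_smul_right] at h
  exact (mul_eq_zero.1 h).resolve_left hu

/-! ### The reproducing kernel Hilbert space -/

/-- The linear map `F ↦ (x ↦ ⟪F, kernelField x⟫)`, which sends the gradient of a mean-zero Sobolev
function `f` to `f * φ_σ`. -/
def smoothOfGradient (hσ : 0 < σ) : gradientSpace d σ →ₗ[ℝ] smoothedSobolevSpace d σ hσ where
  toFun F := ⟨fun x => ⟪(F : Lp (E d) 2 (gauss d σ)), kernelField hσ x⟫, by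
    obtain ⟨f, hf⟩ := exists_memSobolevZero hσ F.2
    refine ⟨f, _, hf, funext fun x => ?_⟩
    rw [hf.smooth_eq hσ, Lp.toLp_coeFn]⟩
  map_add' F G := by
    ext x
    simp [inner_add_left]
  map_smul' c F := by
    ext x
    simp [inner_smul_left]

lemma smoothOfGradient_apply (hσ : 0 < σ) (F : gradientSpace d σ) (x : E d) :
    (smoothOfGradient hσ F).1 x = ⟪(F : Lp (E d) 2 (gauss d σ)), kernelField hσ x⟫ := rfl

lemma smoothOfGradient_toLp (hσ : 0 < σ) {f : E d → ℝ} {F : E d → E d}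
    (hf : MemSobolevZero (gauss d σ) f F) {h : smoothedSobolevSpace d σ hσ}
    (hh : h.1 = smooth σ f) : smoothOfGradient hσ ⟨_, hf.toLp_mem⟩ = h := by
  ext x
  rw [smoothOfGradient_apply, hh, hf.smooth_eq hσ]

lemma smoothOfGradient_bijective (hσ : 0 < σ) :
    Function.Bijective (smoothOfGradient (d := d) hσ) := by
  constructor
  · rw [← LinearMap.ker_eq_bot, LinearMap.ker_eq_bot']
    intro F hF
    obtain ⟨f, hf⟩ := exists_memSobolevZero hσ F.2
    have h0 : smooth σ f = 0 := by
      funext x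
      rw [hf.smooth_eq hσ, Lp.toLp_coeFn, ← smoothOfGradient_apply, hF]
      rfl
    have := hf.grad_eq_zero hσ h0
    rw [Lp.toLp_coeFn] at this
    exact Subtype.ext this
  · rintro ⟨h, f, F, hf, hh⟩
    exact ⟨_, smoothOfGradient_toLp hσ hf hh⟩

/-- The identification of the gradient space with the space of smoothed Sobolev functions. -/
def gradientEquiv (hσ : 0 < σ) : gradientSpace d σ ≃ₗ[ℝ] smoothedSobolevSpace d σ hσ :=
  LinearEquiv.ofBijective (smoothOfGradient hσ) (smoothOfGradient_bijective hσ)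

lemma gradientEquiv_symm_eq (hσ : 0 < σ) {f : E d → ℝ} {F : E d → E d}
    (hf : MemSobolevZero (gauss d σ) f F) {h : smoothedSobolevSpace d σ hσ}
    (hh : h.1 = smooth σ f) : (gradientEquiv hσ).symm h = ⟨_, hf.toLp_mem⟩ := by
  rw [LinearEquiv.symm_apply_eq]
  exact (smoothOfGradient_toLp hσ hf hh).symm

lemma apply_eq_inner_kernelField (hσ : 0 < σ) (h : smoothedSobolevSpace d σ hσ) (x : E d) :
    h.1 x = ⟪((gradientEquiv hσ).symm h : Lp (E d) 2 (gauss d σ)), kernelField hσ x⟫ := by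
  rw [← smoothOfGradient_apply]
  exact congrArg (fun k : smoothedSobolevSpace d σ hσ => k.1 x)
    ((gradientEquiv hσ).apply_symm_apply h).symm

/-- The inner product transported from `L²(N_σ; ℝ^d)` to the space of smoothed functions. -/
@[reducible] def smoothedCore (hσ : 0 < σ) :
    InnerProductSpace.Core ℝ (smoothedSobolevSpace d σ hσ) where
  inner h k := ⟪(gradientEquiv hσ).symm h, (gradientEquiv hσ).symm k⟫
  conj_inner_symm h k := by simp [real_inner_comm]
  re_inner_nonneg h := by simp
  add_left h k l := by rw [map_add, inner_add_left]
  smul_left h k r := by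
    rw [map_smul, Submodule.coe_inner, Submodule.coe_inner, Submodule.coe_smul,
      real_inner_smul_left, conj_trivial]
  definite h hh := by simpa using inner_self_eq_zero.1 hh

/-- Completeness is transported along a linear equivalence that preserves inner products. -/
lemma completeSpace_of_core {H S : Type*} [AddCommGroup H] [Module ℝ H] [NormedAddCommGroup S]
    [InnerProductSpace ℝ S] [CompleteSpace S] (c : InnerProductSpace.Core ℝ H) (e : S ≃ₗ[ℝ] H)
    (he : ∀ a b, c.inner (e a) (e b) = ⟪a, b⟫) :
    @CompleteSpace H
      c.toNormedAddCommGroup.toMetricSpace.toPseudoMetricSpace.toUniformSpace := by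
  let _ := c.toNormedAddCommGroup
  have hiso : Isometry e := by
    refine AddMonoidHomClass.isometry_of_norm e fun a => ?_
    have h1 : ‖e a‖ = √(c.inner (e a) (e a)) := rfl
    rw [h1, he, real_inner_self_eq_norm_sq, Real.sqrt_sq (norm_nonneg _)]
  exact (hiso.isUniformInducing.completeSpace_congr e.surjective).1 inferInstance

lemma posSemidef_of_inner {X V : Type*} [NormedAddCommGroup V] [InnerProductSpace ℝ V]
    (f : X → V) {k : X → X → ℝ} (hk : ∀ x y, ⟪f x, f y⟫ = k x y) :
    (Matrix.of k).PosSemidef := by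
  refine ⟨?_, fun a => ?_⟩
  · ext x y
    simp [← hk, real_inner_comm]
  · have h : (a.sum fun i xi => a.sum fun j xj => star xi * Matrix.of k i j * xj)
        = ⟪a.sum fun i xi => xi • f i, a.sum fun i xi => xi • f i⟫ := by
      simp only [Finsupp.sum, sum_inner, inner_sum, real_inner_smul_left, real_inner_smul_right,
        Matrix.of_apply, hk, star_trivial]
      exact Finset.sum_congr rfl fun i _ => Finset.sum_congr rfl fun j _ => by
        rw [← hk i j, ← hk j i, real_inner_comm]; ring
    rw [h]
    exact real_inner_self_nonneg

instance : CompleteSpace (gradientSpace d σ) :=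
  isClosed_gradientSpace.completeSpace_coe

lemma smoothOfGradient_kernelField (hσ : 0 < σ) (x : E d) :
    (smoothOfGradient hσ ⟨_, kernelField_mem hσ x⟩).1 = fun y => kernel d σ y x := by
  funext y
  rw [smoothOfGradient_apply, real_inner_comm, inner_kernelField_kernelField]

lemma isRKHS_smoothedSobolevSpace (hσ : 0 < σ) :
    IsRKHS (smoothedSobolevSpace d σ hσ) (smoothedCore hσ) (kernel d σ) where
  complete := completeSpace_of_core _ (gradientEquiv hσ) fun a b => by
    change ⟪(gradientEquiv hσ).symm _, (gradientEquiv hσ).symm _⟫ = _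
    simp only [LinearEquiv.symm_apply_apply]
  posSemidef := posSemidef_of_inner (kernelField hσ) (inner_kernelField_kernelField hσ)
  kernel_mem x := by
    rw [← smoothOfGradient_kernelField hσ x]
    exact Subtype.prop _
  reproducing x h := by
    have hk : ∀ hm, (gradientEquiv hσ).symm ⟨fun y => kernel d σ y x, hm⟩
        = ⟨_, kernelField_mem hσ x⟩ := fun hm => by
      rw [LinearEquiv.symm_apply_eq]
      exact Subtype.ext (smoothOfGradient_kernelField hσ x).symm
    rw [apply_eq_inner_kernelField]
    change _ = ⟪(gradientEquiv hσ).symm h, (gradientEquiv hσ).symm _⟫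
    rw [hk, Submodule.coe_inner]

lemma smoothedCore_inner (hσ : 0 < σ) {f g : E d → ℝ} {F G : E d → E d}
    {h k : smoothedSobolevSpace d σ hσ} (hf : MemSobolevZero (gauss d σ) f F)
    (hg : MemSobolevZero (gauss d σ) g G) (hh : h.1 = smooth σ f) (hk : k.1 = smooth σ g) :
    (smoothedCore hσ).inner h k = ∫ x, ⟪F x, G x⟫ ∂(gauss d σ) := by
  change ⟪(gradientEquiv hσ).symm h, (gradientEquiv hσ).symm k⟫ = _
  rw [gradientEquiv_symm_eq hσ hf hh, gradientEquiv_symm_eq hσ hg hk, Submodule.coe_inner,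
    L2.inner_def]
  refine integral_congr_ae ?_
  filter_upwards [hf.memLp_grad.coeFn_toLp, hg.memLp_grad.coeFn_toLp] with t h1 h2
  rw [h1, h2]

/-! ### The smooth Sobolev metric as a distance of kernel mean embeddings -/

lemma norm_kernelField (hσ : 0 < σ) (x : E d) : ‖kernelField hσ x‖ = √(kernel d σ x x) := by
  rw [← inner_kernelField_kernelField hσ, real_inner_self_eq_norm_sq,
    Real.sqrt_sq (norm_nonneg _)]

lemma integrable_kernelField (hσ : 0 < σ) {μ : Measure (E d)}
    (h : Integrable (fun x => √(kernel d σ x x)) μ) : Integrable (kernelField hσ) μ := by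
  refine h.mono (continuous_kernelField hσ).aestronglyMeasurable (ae_of_all _ fun x => ?_)
  rw [norm_kernelField, Real.norm_of_nonneg (Real.sqrt_nonneg _)]

lemma continuous_kernel (hσ : 0 < σ) : Continuous fun p : E d × E d => kernel d σ p.1 p.2 := by
  simp only [← inner_kernelField_kernelField hσ]
  exact ((continuous_kernelField hσ).comp continuous_fst).inner
    ((continuous_kernelField hσ).comp continuous_snd)

lemma integrable_kernel_prod (hσ : 0 < σ) {μ ν : Measure (E d)}
    (hμ : Integrable (fun x => √(kernel d σ x x)) μ)
    (hν : Integrable (fun x => √(kernel d σ x x)) ν) :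
    Integrable (fun p => kernel d σ p.1 p.2) (μ.prod ν) := by
  refine (hμ.mul_prod hν).mono (continuous_kernel hσ).aestronglyMeasurable
    (ae_of_all _ fun p => ?_)
  rw [← inner_kernelField_kernelField hσ, ← norm_kernelField hσ, ← norm_kernelField hσ, norm_mul,
    norm_norm, norm_norm]
  exact norm_inner_le_norm _ _

section embedding

variable {μ ν : Measure (E d)} [IsProbabilityMeasure μ] [IsProbabilityMeasure ν]

lemma inner_integral_kernelField (hσ : 0 < σ)
    (hμ : Integrable (fun x => √(kernel d σ x x)) μ)
    (hν : Integrable (fun x => √(kernel d σ x x)) ν) :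
    ⟪∫ x, kernelField hσ x ∂μ, ∫ y, kernelField hσ y ∂ν⟫
      = ∫ p, kernel d σ p.1 p.2 ∂(μ.prod ν) := by
  rw [integral_prod _ (integrable_kernel_prod hσ hμ hν), real_inner_comm,
    ← integral_inner (integrable_kernelField hσ hμ)]
  congr 1; ext x
  rw [real_inner_comm, ← integral_inner (integrable_kernelField hσ hν)]
  simp only [inner_kernelField_kernelField]

lemma integral_conv_gauss (hσ : 0 < σ) (hμ : Integrable (fun x => √(kernel d σ x x)) μ)
    {f : E d → ℝ} (hf : ContDiff ℝ ∞ f) (hc : HasCompactSupport f) :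
    ∫ x, f x ∂(μ.conv (gauss d σ)) = (∫ x, f x ∂(gauss d σ))
      + ⟪(memLp_gradient hf hc).toLp, ∫ x, kernelField hσ x ∂μ⟫ := by
  rw [integral_conv (hf.continuous.integrable_of_hasCompactSupport hc)]
  have ht : f ∈ testFunctions d := ⟨f, 0, hf, hc, by simp⟩
  have h1 : ∀ x, ∫ y, f (x + y) ∂(gauss d σ) = (∫ x, f x ∂(gauss d σ))
      + ⟪(memLp_gradient hf hc).toLp, kernelField hσ x⟫ := by
    intro x
    have h := smooth_sub_test hσ ht 0 x
    simp only [zero_add] at h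
    rw [← inner_kernelField, sub_eq_iff_eq_add', smooth_zero_eq_integral hσ,
      smooth_apply_translate hσ] at h
    exact h
  simp only [h1]
  have hi := integrable_kernelField hσ hμ
  rw [integral_add (integrable_const _) (hi.const_inner _), integral_inner hi]
  simp

lemma integral_signedMeasure (hσ : 0 < σ) (hμ : Integrable (fun x => √(kernel d σ x x)) μ)
    (hν : Integrable (fun x => √(kernel d σ x x)) ν)
    {f : E d → ℝ} (hf : ContDiff ℝ ∞ f) (hc : HasCompactSupport f) :
    (∫ᵛ x, f x ∂<•((μ.conv (gauss d σ)).toSignedMeasure - (ν.conv (gauss d σ)).toSignedMeasure))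
      = ⟪(memLp_gradient hf hc).toLp,
        (∫ x, kernelField hσ x ∂μ) - ∫ x, kernelField hσ x ∂ν⟫ := by
  have hi : ∀ (ρ : Measure (E d)) [IsFiniteMeasure ρ], ρ.toSignedMeasure.Integrable f := by
    intro ρ _
    rw [VectorMeasure.Integrable, Measure.variation_toSignedMeasure]
    exact hf.continuous.integrable_of_hasCompactSupport hc
  rw [VectorMeasure.integral_sub_vectorMeasure (hi _) (hi _),
    VectorMeasure.integral_toSignedMeasure, VectorMeasure.integral_toSignedMeasure,
    integral_conv_gauss hσ hμ hf hc, integral_conv_gauss hσ hν hf hc, inner_sub_right]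
  ring

lemma integral_kernelField_mem (hσ : 0 < σ)
    (hμ : Integrable (fun x => √(kernel d σ x x)) μ) :
    ∫ x, kernelField hσ x ∂μ ∈ gradientSpace d σ :=
  (gradientSpace d σ).convex.integral_mem isClosed_gradientSpace
    (ae_of_all _ fun x => kernelField_mem hσ x) (integrable_kernelField hσ hμ)

lemma norm_toLp_le_one_iff {F : E d → E d} {γ : Measure (E d)} (hF : MemLp F 2 γ) :
    eLpNorm F 2 γ ≤ 1 ↔ ‖hF.toLp‖ ≤ 1 := by
  rw [Lp.norm_toLp]
  exact (ENNReal.toReal_le_toReal hF.2.ne ENNReal.one_ne_top).symm.trans (by simp)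

/-- By density of the gradients of test functions, the dual norm of the difference is the norm of
the difference of the mean embeddings. -/
lemma smoothSobolevIPM_eq_norm (hσ : 0 < σ) (hμ : Integrable (fun x => √(kernel d σ x x)) μ)
    (hν : Integrable (fun x => √(kernel d σ x x)) ν) :
    smoothSobolevIPM σ μ ν
      = (‖(∫ x, kernelField hσ x ∂μ) - ∫ x, kernelField hσ x ∂ν‖ : ℝ) := by
  set m := (∫ x, kernelField hσ x ∂μ) - ∫ x, kernelField hσ x ∂ν with hm
  have hmem : m ∈ gradientSpace d σ :=
    Submodule.sub_mem _ (integral_kernelField_mem hσ hμ) (integral_kernelField_mem hσ hν)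
  have hval : ∀ {f : E d → ℝ} (hf : ContDiff ℝ ∞ f) (hc : HasCompactSupport f),
      eLpNorm (∇ f) 2 (gauss d σ) ≤ 1 →
      ((⟪(memLp_gradient hf hc).toLp, m⟫ : ℝ) : EReal) ≤ smoothSobolevIPM σ μ ν := by
    intro f hf hc h1
    rw [← integral_signedMeasure hσ hμ hν hf hc]
    exact le_iSup₂_of_le f ⟨hf, hc, h1⟩ le_rfl
  apply le_antisymm
  · refine iSup₂_le fun f ⟨hf, hc, h1⟩ => ?_
    rw [integral_signedMeasure hσ hμ hν hf hc, EReal.coe_le_coe_iff]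
    rw [norm_toLp_le_one_iff (memLp_gradient hf hc)] at h1
    refine (real_inner_le_norm _ _).trans ?_
    exact mul_le_of_le_one_left (norm_nonneg _) h1
  · rcases eq_or_ne m 0 with h0 | h0
    · have h := hval (f := 0) contDiff_const HasCompactSupport.zero (by
        have : ∇ (0 : E d → ℝ) = 0 := gradient_const' (0 : ℝ)
        simp [this])
      simpa [h0] using h
    · obtain ⟨G, hG, hlim⟩ := mem_closure_iff_seq_limit.1 hmem
      have hm0 : 0 < ‖m‖ := norm_pos_iff.2 h0
      -- normalizing by `max ‖G n‖ ‖m‖` keeps the approximations in the unit ball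
      have ht : Tendsto (fun n => (max ‖G n‖ ‖m‖)⁻¹ * ⟪G n, m⟫) atTop (𝓝 ‖m‖) := by
        have h1 : Tendsto (fun n => max ‖G n‖ ‖m‖) atTop (𝓝 ‖m‖) := by
          simpa using hlim.norm.max (tendsto_const_nhds (x := ‖m‖))
        have h2 := (h1.inv₀ hm0.ne').mul (hlim.inner (tendsto_const_nhds (x := m)))
        rw [real_inner_self_eq_norm_sq] at h2
        convert h2 using 2
        field_simp
      refine le_of_tendsto' ((continuous_coe_real_ereal.tendsto _).comp ht) fun n => ?_
      obtain ⟨g, hg, hc, he⟩ := hG n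
      set r := (max ‖G n‖ ‖m‖)⁻¹ with hr
      have hgr : ContDiff ℝ ∞ (r • g) := contDiff_const.smul hg
      have hcr : HasCompactSupport (r • g) := hc.smul_left (f := fun _ => r)
      have he' : (memLp_gradient hgr hcr).toLp = r • G n := by
        rw [he, ← MemLp.toLp_const_smul]
        simp only [gradient_smul' r hg]
      have h := hval hgr hcr (by
        rw [norm_toLp_le_one_iff (memLp_gradient hgr hcr), he', norm_smul,
          Real.norm_of_nonneg (by positivity), hr, inv_mul_le_one₀ (by positivity)]
        exact le_max_left _ _)
      rwa [he', real_inner_smul_left] at h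

lemma smoothSobolevIPM_sq (hσ : 0 < σ) (hμ : Integrable (fun x => √(kernel d σ x x)) μ)
    (hν : Integrable (fun x => √(kernel d σ x x)) ν) :
    smoothSobolevIPM σ μ ν ^ 2 =
      (((∫ p, kernel d σ p.1 p.2 ∂(μ.prod μ)) + (∫ p, kernel d σ p.1 p.2 ∂(ν.prod ν))
        - 2 * ∫ p, kernel d σ p.1 p.2 ∂(μ.prod ν) : ℝ) : EReal) := by
  rw [smoothSobolevIPM_eq_norm hσ hμ hν, ← EReal.coe_pow, norm_sub_sq_real,
    ← real_inner_self_eq_norm_sq, ← real_inner_self_eq_norm_sq,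
    inner_integral_kernelField hσ hμ hμ, inner_integral_kernelField hσ hν hν,
    inner_integral_kernelField hσ hμ hν]
  congr 1; ring

end embedding

end SmoothSobolev

end

theorem theorem4 (d : ℕ) (σ : ℝ) (hσ : 0 < σ) :
    (∃ c : InnerProductSpace.Core ℝ (SmoothSobolev.smoothedSobolevSpace d σ hσ),
      (∀ (f g : SmoothSobolev.E d → ℝ) (F G : SmoothSobolev.E d → SmoothSobolev.E d)
        (h k : SmoothSobolev.smoothedSobolevSpace d σ hσ),
        SmoothSobolev.MemSobolevZero (SmoothSobolev.gauss d σ) f F →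
        SmoothSobolev.MemSobolevZero (SmoothSobolev.gauss d σ) g G →
        h.1 = SmoothSobolev.smooth σ f → k.1 = SmoothSobolev.smooth σ g →
        c.inner h k = ∫ x, ⟪F x, G x⟫ ∂(SmoothSobolev.gauss d σ)) ∧
      SmoothSobolev.IsRKHS (SmoothSobolev.smoothedSobolevSpace d σ hσ) c
        (SmoothSobolev.kernel d σ)) ∧
    ∀ (μ ν : Measure (SmoothSobolev.E d)) [IsProbabilityMeasure μ] [IsProbabilityMeasure ν],
      Integrable (fun x => √(SmoothSobolev.kernel d σ x x)) μ →
      Integrable (fun y => √(SmoothSobolev.kernel d σ y y)) ν →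
      Integrable (fun p => SmoothSobolev.kernel d σ p.1 p.2) (μ.prod μ) ∧
      Integrable (fun p => SmoothSobolev.kernel d σ p.1 p.2) (ν.prod ν) ∧
      Integrable (fun p => SmoothSobolev.kernel d σ p.1 p.2) (μ.prod ν) ∧
      SmoothSobolev.smoothSobolevIPM σ μ ν ^ 2 =
        (((∫ p, SmoothSobolev.kernel d σ p.1 p.2 ∂(μ.prod μ))
          + (∫ p, SmoothSobolev.kernel d σ p.1 p.2 ∂(ν.prod ν))
          - 2 * ∫ p, SmoothSobolev.kernel d σ p.1 p.2 ∂(μ.prod ν) : ℝ) : EReal) := by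
  refine ⟨⟨SmoothSobolev.smoothedCore hσ, fun f g F G h k hf hg hh hk =>
    SmoothSobolev.smoothedCore_inner hσ hf hg hh hk,
    SmoothSobolev.isRKHS_smoothedSobolevSpace hσ⟩, fun μ ν _ _ hμ hν => ?_⟩
  exact ⟨SmoothSobolev.integrable_kernel_prod hσ hμ hμ,
    SmoothSobolev.integrable_kernel_prod hσ hν hν,
    SmoothSobolev.integrable_kernel_prod hσ hμ hν, SmoothSobolev.smoothSobolevIPM_sq hσ hμ hν⟩
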